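/- A polynomial $p\in\mathbb{R}[z_1,\dots,z_n]$ is *real stable* if $p(z)\neq 0$ whenever $\operatorname{Im} z_i>0$ for all $i$, and *multiaffine* if it has degree at most $1$ in each variable. A point $\mathbf{a}\in\mathbb{R}^n$ is *above the roots* of $p$ if $p(\mathbf{a}+\mathbf{t})\neq 0$ for every $\mathbf{t}\in\mathbb{R}^n$ with all $t_i\ge 0$. Let $k\ge 1$. For a polynomial $p=\sum_{\kappa}a_\kappa z^\kappa$ of degree at most $k$ in each variable, its polarization is the polynomial in the variables $z_{i,j}$ ($1\le i\le n$, $1\le j\le k$) $$\operatorname{Pol}(p)=\sum_{\kappa}a_\kappa\prod_{i=1}^n\frac{e_{\kappa_i}(z_{i,1},\dots,z_{i,k})}{\binom{k}{\kappa_i}},$$ where $e_d$ is the elementary symmetric polynomial of degree $d$. For a multiaffine $q\in\mathbb{R}[z_1,\dots,z_n]$ let $$\tilde q(z_{1,1},\dots,z_{n,k})=q\Big(\sum_{j=1}^k z_{1,j},\dots,\sum_{j=1}^k z_{n,j}\Big),$$ which is again multiaffine, and let $\overline{\tilde q}$ be its flip, where the flip of a multiaffine polynomial $\sum_{S\subseteq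 E}a_S z^S$ in variables indexed by a finite set $E$ is $\sum_{S\subseteq E} a_S z^{E\setminus S}$. For $\mathbf{a}\in\mathbb{R}^n$ let $\overline{\mathbf{a}}\in\mathbb{R}^{nk}$ be the point with $\overline a_{i,j}=a_i$ for all $i,j$. **Theorem.** Let $p,q\in\mathbb{R}[z_1,\dots,z_n]$ be real stable, let $p$ have degree at most $k$ in each variable, where $k\ge1$, and let $q$ be multiaffine. Assume that $q(\partial)p:=q(\partial_1,\dots,\partial_n)p$ is not the zero polynomial. Let $\mathbf{a}\in\mathbb{R}^n$ be above the roots of $p$ and let $\mathbf{b}\in\mathbb{R}^n$ be such that $\overline{\mathbf{b}}$ is above the roots of $\overline{\tilde q}$. Put $$\varphi_i=\frac{\partial_{i,1}\operatorname{Pol}(p)}{\operatorname{Pol}(p)}(\overline{\mathbf{a}})+\frac{\partial_{i,1}\overline{\tilde q}}{\overline{\tilde q}}(\overline{\mathbf{b}}),\qquad 1\le i\le n.$$ Then $\varphi_i>0$ for every $i$, and the point $$\mathbf{c}=\mathbf{a}+\mathbf{b}-\Big(\frac1{\varphi_1},\dots,\frac1{\varphi_n}\Big)$$ is above the roots of $q(\partial)p$.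 -/

import Mathlib

namespace ALS

open MvPolynomial

/-- A real polynomial is real stable if it does not vanish when every variable lies in the open
upper half plane. -/
def RealStable {σ : Type*} (p : MvPolynomial σ ℝ) : Prop :=
  ∀ z : σ → ℂ, (∀ i, 0 < (z i).im) → aeval z p ≠ 0

/-- Degree at most one in each variable. -/
def Multiaffine {σ : Type*} (p : MvPolynomial σ ℝ) : Prop :=
  ∀ i, p.degreeOf i ≤ 1

/-- The point `a` is above the roots of `p`: `p (a + t) ≠ 0` for every `t` in the closed
nonnegative orthant. -/
def AboveRoots {σ : Type*} (a : σ → ℝ) (p : MvPolynomial σ ℝ) : Prop :=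
  ∀ t : σ → ℝ, (∀ i, 0 ≤ t i) → eval (a + t) p ≠ 0

/-- The logarithmic potential `(∂ᵢ p / p)(a)`. -/
noncomputable def potential {σ : Type*} (i : σ) (p : MvPolynomial σ ℝ) (a : σ → ℝ) : ℝ :=
  eval a (pderiv i p) / eval a p

/-- The partial derivative `∂ᵢ` as a linear endomorphism of the polynomial ring. -/
noncomputable def partialD {σ : Type*} (i : σ) : Module.End ℝ (MvPolynomial σ ℝ) :=
  (pderiv i).toLinearMap

theorem partialD_commute {σ : Type*} (i j : σ) :
    Commute (partialD i) (partialD j) := by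
  refine LinearMap.ext fun p => ?_
  have h : ⁅(pderiv i : Derivation ℝ (MvPolynomial σ ℝ) (MvPolynomial σ ℝ)),
      (pderiv j : Derivation ℝ (MvPolynomial σ ℝ) (MvPolynomial σ ℝ))⁆ = 0 := by
    refine MvPolynomial.derivation_ext fun l => ?_
    classical
    rw [Derivation.commutator_apply, pderiv_X, pderiv_X, Derivation.zero_apply,
      Pi.single_apply, Pi.single_apply]
    split_ifs <;> simp
  have := DFunLike.congr_fun h p
  rw [Derivation.commutator_apply, Derivation.zero_apply, sub_eq_zero] at this
  exact this

/-- The differential monomial `∂^m = ∏ᵢ ∂ᵢ ^ (m i)`; the factors commute. -/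
noncomputable def monomialD {σ : Type*} [Fintype σ] (m : σ →₀ ℕ) :
    Module.End ℝ (MvPolynomial σ ℝ) :=
  Finset.univ.noncommProd (fun i => partialD i ^ m i)
    (fun i _ j _ _ => (partialD_commute i j).pow_pow (m i) (m j))

/-- The polynomial `q(∂) p`. -/
noncomputable def diffOp {σ : Type*} [Fintype σ] (q p : MvPolynomial σ ℝ) :
    MvPolynomial σ ℝ :=
  ∑ m ∈ q.support, coeff m q • monomialD m p

/-- The flip of a multiaffine polynomial: `∑_S a_S z^S` becomes `∑_S a_S z^(Sᶜ)`. The exponent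
vectors of a multiaffine polynomial take values in `{0, 1}`, and `m` is sent to `1 - m`. -/
noncomputable def flip {σ : Type*} [Fintype σ] (q : MvPolynomial σ ℝ) : MvPolynomial σ ℝ :=
  ∑ m ∈ q.support, monomial (Finsupp.equivFunOnFinite.symm fun i => 1 - m i) (coeff m q)

/-- The polarization of a polynomial of degree at most `k` in each variable: `zᵢ ^ d` is replaced
by `e_d(z_{i,1}, …, z_{i,k}) / (k choose d)`. -/
noncomputable def polarization {σ : Type*} [Fintype σ] (k : ℕ) (p : MvPolynomial σ ℝ) :
    MvPolynomial (σ × Fin k) ℝ :=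
  ∑ m ∈ p.support, C (coeff m p) *
    ∏ i, (C ((k.choose (m i) : ℝ)⁻¹) * rename (fun j => (i, j)) (esymm (Fin k) ℝ (m i)))

/-- `q̃`, the polynomial `q` with each `zᵢ` replaced by `z_{i,1} + ⋯ + z_{i,k}`. -/
noncomputable def tilde {σ : Type*} (k : ℕ) (q : MvPolynomial σ ℝ) :
    MvPolynomial (σ × Fin k) ℝ :=
  aeval (fun i => ∑ j : Fin k, (X (i, j) : MvPolynomial (σ × Fin k) ℝ)) q

/-- The point in which each coordinate of `a` is repeated `k` times. -/
def repeated {σ : Type*} (k : ℕ) (a : σ → ℝ) : σ × Fin k → ℝ :=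
  fun ij => a ij.1

end ALS

/-!
Polarization and the substitution `q ↦ q̃` reduce the theorem to multiaffine polynomials: setting
all variables of each block equal turns `q̃(∂) Pol(p)` back into `q(∂) p`. By the theorem of Grace,
Walsh and Szegő polarization preserves stability and the points above the roots, and by symmetry
the potentials at a diagonal point agree within each block.

For multiaffine `f` and `h`, `h(∂) f` evaluated at `x + y` is `∏ᵢ (∂_{xᵢ} + ∂_{yᵢ})` applied to
`f(x) h̄(y)`. Applying the factors one at a time is a barrier argument in the style of Marcus,
Spielman and Srivastava: if `δ` times the sum of the potentials in the directions `x` and `y` is at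
most `1`, then after applying `∂ₓ + ∂_y` the point may be lowered by `δ` in the direction `x`; it
stays above the roots and no potential increases. For multiaffine polynomials this follows from
Rayleigh's inequality in the directions `x` and `y` along the lines in a third direction.
-/

namespace ALS

open Filter Topology

theorem forall_of_forall_update {ι α : Type*} [Finite ι] [DecidableEq ι] {A B : ι → Set α}
    (hAB : ∀ i, A i ⊆ B i) {P : (ι → α) → Prop} (base : ∀ u, (∀ i, u i ∈ A i) → P u)
    (step : ∀ i u, (∀ l, u l ∈ B l) → (∀ a ∈ A i, P (Function.update u i a)) → P u)
    (u : ι → α) (hu : ∀ i, u i ∈ B i) : P u := by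
  have := Fintype.ofFinite ι
  suffices h : ∀ (S : Finset ι) (u : ι → α), (∀ i, u i ∈ B i) → (∀ i ∉ S, u i ∈ A i) → P u from
    h Finset.univ u hu fun i hi => absurd (Finset.mem_univ i) hi
  intro S
  induction S using Finset.induction_on with
  | empty => exact fun u _ hA => base u fun i => hA i (Finset.notMem_empty i)
  | insert i S _ ih =>
    refine fun u hB hA => step i u hB fun a ha => ih _ (fun l => ?_) fun l hl => ?_
    · rcases eq_or_ne l i with rfl | h
      · simpa using hAB l ha
      · simpa [h] using hB l
    · rcases eq_or_ne l i with rfl | h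
      · simpa using ha
      · simpa [h] using hA l (by simp [h, hl])

section GraceWalshSzego

open Polynomial

/-- The open half plane `Re (ω z) > c` for `ω ≠ 0`. -/
def halfPlane (ω : ℂ) (c : ℝ) : Set ℂ :=
  {z | c < (ω * z).re}

theorem mem_halfPlane {ω : ℂ} {c : ℝ} {z : ℂ} : z ∈ halfPlane ω c ↔ c < (ω * z).re :=
  Iff.rfl

/-- The image of the half plane `κ ≤ Re (ω z)` under `z ↦ z⁻¹`, together with `0`. For `κ > 0` it
is a closed disc. -/
def invHalfPlane (ω : ℂ) (κ : ℝ) : Set ℂ :=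
  {ζ | κ * ‖ζ‖ ^ 2 ≤ (ω * starRingEnd ℂ ζ).re}

theorem inv_mem_invHalfPlane {ω u : ℂ} {κ : ℝ} (hu : u ≠ 0) :
    u⁻¹ ∈ invHalfPlane ω κ ↔ κ ≤ (ω * u).re := by
  have hpos : 0 < (‖u‖ ^ 2)⁻¹ := by positivity
  have hre : (ω * starRingEnd ℂ u⁻¹).re = (ω * u).re * (‖u‖ ^ 2)⁻¹ := by
    rw [Complex.inv_def, map_mul, Complex.conj_conj, Complex.conj_ofReal, ← mul_assoc,
      Complex.re_mul_ofReal, Complex.normSq_eq_norm_sq]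
  rw [invHalfPlane, Set.mem_ofPred_eq, hre, norm_inv, inv_pow, mul_le_mul_iff_left₀ hpos]

theorem convex_invHalfPlane (ω : ℂ) {κ : ℝ} (hκ : 0 ≤ κ) : Convex ℝ (invHalfPlane ω κ) := by
  intro x hx y hy s t hs ht hst
  have hnorm : ‖s • x + t • y‖ ^ 2 ≤ s * ‖x‖ ^ 2 + t * ‖y‖ ^ 2 :=
    ((convexOn_norm convex_univ).pow (fun _ _ => norm_nonneg _) 2).2 trivial trivial hs ht hst
  calc κ * ‖s • x + t • y‖ ^ 2
      ≤ s * (κ * ‖x‖ ^ 2) + t * (κ * ‖y‖ ^ 2) := by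
        linarith [mul_le_mul_of_nonneg_left hnorm hκ]
    _ ≤ s * (ω * starRingEnd ℂ x).re + t * (ω * starRingEnd ℂ y).re :=
        add_le_add (mul_le_mul_of_nonneg_left hx hs) (mul_le_mul_of_nonneg_left hy ht)
    _ = (ω * starRingEnd ℂ (s • x + t • y)).re := by
        simp only [Complex.mul_re, Complex.conj_re, Complex.conj_im, mul_neg, sub_neg_eq_add,
          mul_add, Complex.real_smul, map_add, map_mul, Complex.conj_ofReal, Complex.add_re,
          Complex.ofReal_re, Complex.ofReal_im, zero_mul, neg_zero, sub_zero, Complex.mul_im,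
          add_zero]
        ring

theorem zero_mem_invHalfPlane (ω : ℂ) (κ : ℝ) : 0 ∈ invHalfPlane ω κ := by
  simp [invHalfPlane]

open Pointwise in
theorem multiset_sum_mem_card_smul {E : Type*} [AddCommGroup E] [Module ℝ E] {D : Set E}
    (hD : Convex ℝ D) (h0 : (0 : E) ∈ D) {s : Multiset E} (hs : ∀ x ∈ s, x ∈ D) :
    s.sum ∈ (s.card : ℝ) • D := by
  induction s using Multiset.induction_on with
  | empty => exact ⟨0, h0, by simp⟩
  | cons x s ih =>
    rw [Multiset.sum_cons, Multiset.card_cons, Nat.cast_add_one, add_comm x,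
      hD.add_smul (Nat.cast_nonneg _) zero_le_one, one_smul]
    exact Set.add_mem_add (ih fun y hy => hs y (Multiset.mem_cons_of_mem hy))
      (hs x (Multiset.mem_cons_self x s))

theorem inv_smul_multiset_sum_mem {E : Type*} [AddCommGroup E] [Module ℝ E] {D : Set E}
    (hD : Convex ℝ D) (h0 : (0 : E) ∈ D) {s : Multiset E} (hs : ∀ x ∈ s, x ∈ D) {K : ℕ}
    (hsK : s.card ≤ K) : (K : ℝ)⁻¹ • s.sum ∈ D := by
  obtain ⟨x, hx, hxs⟩ := multiset_sum_mem_card_smul hD h0 hs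
  rw [← hxs, smul_smul, inv_mul_eq_div]
  exact hD.smul_mem_of_zero_mem h0 hx
    ⟨by positivity, div_le_one_of_le₀ (by exact_mod_cast hsK) (Nat.cast_nonneg K)⟩

/-- The polar derivative with respect to the point `z`, for polynomials of degree at most `K`,
normalized so that its value at `z` is the value of `f`. -/
noncomputable def polarDerivative {𝕜 : Type*} [Field 𝕜] (K : ℕ) (z : 𝕜) (f : 𝕜[X]) : 𝕜[X] :=
  f + (C z - X) * (C (K : 𝕜)⁻¹ * derivative f)

theorem eval_polarDerivative {𝕜 : Type*} [Field 𝕜] (K : ℕ) (z w : 𝕜) (f : 𝕜[X]) :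
    (polarDerivative K z f).eval w = f.eval w + (z - w) * ((K : 𝕜)⁻¹ * f.derivative.eval w) := by
  simp [polarDerivative]

theorem coeff_polarDerivative {𝕜 : Type*} [Field 𝕜] {K : ℕ} (hK : (K : 𝕜) ≠ 0) (z : 𝕜)
    (f : 𝕜[X]) (d : ℕ) :
    (polarDerivative K z f).coeff d =
      f.coeff d * ((K - d) / K) + f.coeff (d + 1) * (z * ((d + 1) / K)) := by
  rw [polarDerivative, coeff_add, sub_mul, coeff_sub, coeff_C_mul, coeff_C_mul]
  rcases d with _ | d
  · simp only [coeff_derivative, zero_add, Nat.cast_zero, mul_one, mul_coeff_zero, coeff_X_zero,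
      coeff_C_zero, zero_mul, sub_zero]
    field_simp
  · rw [coeff_X_mul, coeff_C_mul, coeff_derivative, coeff_derivative]
    push_cast
    field_simp
    ring

theorem natDegree_polarDerivative_le {𝕜 : Type*} [Field 𝕜] [CharZero 𝕜] {K : ℕ} (z : 𝕜)
    {f : 𝕜[X]} (hf : f.natDegree ≤ K + 1) : (polarDerivative (K + 1) z f).natDegree ≤ K := by
  refine natDegree_le_iff_coeff_eq_zero.mpr fun d hd => ?_
  rw [coeff_polarDerivative (Nat.cast_ne_zero.mpr K.succ_ne_zero),
    coeff_eq_zero_of_natDegree_lt (hf.trans_lt (Nat.succ_lt_succ hd))]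
  rcases eq_or_lt_of_le (Nat.succ_le_of_lt hd) with rfl | h
  · simp
  · simp [coeff_eq_zero_of_natDegree_lt (hf.trans_lt h)]

/-- **Laguerre's theorem** for a half plane. -/
theorem polarDerivative_eval_ne_zero {ω : ℂ} {c : ℝ} {K : ℕ} {f : ℂ[X]}
    (hf : f.natDegree ≤ K) (hne : ∀ z ∈ halfPlane ω c, f.eval z ≠ 0) {z w : ℂ}
    (hz : z ∈ halfPlane ω c) (hw : w ∈ halfPlane ω c) : (polarDerivative K z f).eval w ≠ 0 := by
  intro h0
  have hfw := hne w hw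
  set κ := (ω * w).re - c with hκ
  set s := f.roots.map fun r => 1 / (w - r)
  have hroots : ∀ ζ ∈ s, ζ ∈ invHalfPlane ω κ := by
    intro ζ hζ
    obtain ⟨r, hr, rfl⟩ := Multiset.mem_map.mp hζ
    have hr0 : f.eval r = 0 := (mem_roots'.mp hr).2
    have hrc : (ω * r).re ≤ c := not_lt.mp fun h => hne r h hr0
    rw [one_div, inv_mem_invHalfPlane (sub_ne_zero.mpr fun h => hfw (by rwa [h])), mul_sub,
      Complex.sub_re]
    linarith
  -- The average of the points `1 / (w - r)` stays in the disc, but is `1 / (w - z)`.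
  have hmean : (K : ℝ)⁻¹ • s.sum ∈ invHalfPlane ω κ :=
    inv_smul_multiset_sum_mem (convex_invHalfPlane ω (sub_nonneg.mpr hw.le))
      (zero_mem_invHalfPlane ω κ) hroots
      (by simpa only [s, Multiset.card_map] using (card_roots' f).trans hf)
  rw [Complex.real_smul, Complex.ofReal_inv, Complex.ofReal_natCast] at hmean
  rw [eval_polarDerivative, (IsAlgClosed.splits f).eval_derivative_eq_eval_mul_sum hfw] at h0
  have hinv : (w - z) * ((K : ℂ)⁻¹ * s.sum) = 1 :=
    mul_left_cancel₀ hfw (by linear_combination -h0)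
  rw [eq_inv_of_mul_eq_one_right hinv, inv_mem_invHalfPlane (left_ne_zero_of_mul_eq_one hinv),
    mul_sub, Complex.sub_re] at hmean
  rw [mem_halfPlane] at hz
  linarith

theorem multiset_esymm_cons_succ {R : Type*} [CommSemiring R] (a : R) (s : Multiset R) (d : ℕ) :
    (a ::ₘ s).esymm (d + 1) = s.esymm (d + 1) + a * s.esymm d := by
  simp [Multiset.esymm, Multiset.powersetCard_cons, Multiset.sum_map_mul_left]

theorem multiset_esymm_zero {R : Type*} [CommSemiring R] (s : Multiset R) : s.esymm 0 = 1 := by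
  simp [Multiset.esymm]

theorem multiset_esymm_of_card_lt {R : Type*} [CommSemiring R] (s : Multiset R) {d : ℕ}
    (h : s.card < d) : s.esymm d = 0 := by
  simp [Multiset.esymm, Multiset.powersetCard_eq_empty d h]

/-- The elementary symmetric mean: the average of the products of `d` of the elements of `s`.
It is `0` for `d > card s`. -/
noncomputable def esymmMean {𝕜 : Type*} [Field 𝕜] (s : Multiset 𝕜) (d : ℕ) : 𝕜 :=
  (s.card.choose d : 𝕜)⁻¹ * s.esymm d

theorem esymmMean_zero {𝕜 : Type*} [Field 𝕜] (s : Multiset 𝕜) : esymmMean s 0 = 1 := by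
  simp [esymmMean, multiset_esymm_zero]

theorem esymmMean_of_card_lt {𝕜 : Type*} [Field 𝕜] {s : Multiset 𝕜} {d : ℕ} (h : s.card < d) :
    esymmMean s d = 0 := by
  rw [esymmMean, multiset_esymm_of_card_lt s h, mul_zero]

theorem inv_choose_succ_succ {𝕜 : Type*} [Field 𝕜] [CharZero 𝕜] {K d : ℕ} (hd : d ≤ K) :
    ((K + 1).choose (d + 1) : 𝕜)⁻¹ = (d + 1) / (K + 1) * (K.choose d : 𝕜)⁻¹ := by
  have hK : (K : 𝕜) + 1 ≠ 0 := by exact_mod_cast K.succ_ne_zero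
  have hchoose : (K.choose d : 𝕜) ≠ 0 := by exact_mod_cast (Nat.choose_pos hd).ne'
  have hchoose' : ((K + 1).choose (d + 1) : 𝕜) ≠ 0 := by
    exact_mod_cast (Nat.choose_pos (Nat.succ_le_succ hd)).ne'
  have h : ((K : 𝕜) + 1) * K.choose d = (K + 1).choose (d + 1) * (d + 1) := by
    exact_mod_cast Nat.add_one_mul_choose_eq K d
  field_simp
  exact h

theorem inv_choose_succ {𝕜 : Type*} [Field 𝕜] [CharZero 𝕜] {K d : ℕ} (hd : d ≤ K) :
    ((K + 1).choose d : 𝕜)⁻¹ = (K + 1 - d) / (K + 1) * (K.choose d : 𝕜)⁻¹ := by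
  have hK : (K : 𝕜) + 1 ≠ 0 := by exact_mod_cast K.succ_ne_zero
  have hchoose : (K.choose d : 𝕜) ≠ 0 := by exact_mod_cast (Nat.choose_pos hd).ne'
  have hchoose' : ((K + 1).choose d : 𝕜) ≠ 0 := by
    exact_mod_cast (Nat.choose_pos (Nat.le_succ_of_le hd)).ne'
  have h : ((K : 𝕜) + 1) * K.choose d = (K + 1).choose d * (K + 1 - d) := by
    have := Nat.choose_mul_succ_eq K d
    rw [mul_comm, ← Nat.cast_add_one, ← Nat.cast_sub (Nat.le_succ_of_le hd)]
    exact_mod_cast this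
  field_simp
  exact h

theorem esymmMean_cons_succ {𝕜 : Type*} [Field 𝕜] [CharZero 𝕜] (z : 𝕜) (s : Multiset 𝕜) {d : ℕ}
    (hd : d ≤ s.card) :
    esymmMean (z ::ₘ s) (d + 1) =
      (s.card - d) / (s.card + 1) * esymmMean s (d + 1) +
        z * ((d + 1) / (s.card + 1)) * esymmMean s d := by
  have hlow : ((s.card + 1).choose (d + 1) : 𝕜)⁻¹ * s.esymm (d + 1) =
      (s.card - d) / (s.card + 1) * esymmMean s (d + 1) := by
    rcases hd.eq_or_lt with rfl | hlt
    · simp [esymmMean, multiset_esymm_of_card_lt]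
    · rw [inv_choose_succ hlt, esymmMean]
      push_cast
      ring
  have hhigh : ((s.card + 1).choose (d + 1) : 𝕜)⁻¹ * s.esymm d =
      (d + 1) / (s.card + 1) * esymmMean s d := by
    rw [inv_choose_succ_succ hd, esymmMean, mul_assoc]
  rw [esymmMean, multiset_esymm_cons_succ, Multiset.card_cons, mul_add, hlow, mul_left_comm, hhigh,
    mul_assoc z]

/-- The polarization of a univariate polynomial of degree at most `card s`, evaluated at the
points of `s`, as a linear functional of the polynomial. -/
noncomputable def polarEval {𝕜 : Type*} [Field 𝕜] (s : Multiset 𝕜) : 𝕜[X] →ₗ[𝕜] 𝕜 :=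
  ∑ d ∈ Finset.range (s.card + 1), esymmMean s d • lcoeff 𝕜 d

theorem polarEval_apply {𝕜 : Type*} [Field 𝕜] (s : Multiset 𝕜) (f : 𝕜[X]) :
    polarEval s f = ∑ d ∈ Finset.range (s.card + 1), esymmMean s d * f.coeff d := by
  simp [polarEval]

theorem polarEval_C_mul_X_pow {𝕜 : Type*} [Field 𝕜] (s : Multiset 𝕜) (a : 𝕜) (d : ℕ) :
    polarEval s (C a * X ^ d) = a * esymmMean s d := by
  simp only [polarEval_apply, coeff_C_mul, coeff_X_pow, mul_ite, mul_one, mul_zero,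
    Finset.sum_ite_eq', Finset.mem_range, Nat.lt_succ_iff]
  split_ifs with h
  · exact mul_comm _ _
  · rw [esymmMean_of_card_lt (not_le.mp h), mul_zero]

theorem polarEval_cons {𝕜 : Type*} [Field 𝕜] [CharZero 𝕜] (z : 𝕜) (s : Multiset 𝕜) (f : 𝕜[X]) :
    polarEval (z ::ₘ s) f = polarEval s (polarDerivative (s.card + 1) z f) := by
  have hK : ((s.card + 1 : ℕ) : 𝕜) ≠ 0 := Nat.cast_ne_zero.mpr s.card.succ_ne_zero
  have hcoeff : ∀ d, esymmMean s d * (polarDerivative (s.card + 1) z f).coeff d =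
      (s.card + 1 - d) / (s.card + 1) * esymmMean s d * f.coeff d +
        z * ((d + 1) / (s.card + 1)) * esymmMean s d * f.coeff (d + 1) := by
    intro d
    rw [coeff_polarDerivative hK]
    push_cast
    ring
  have hshift : ∑ d ∈ Finset.range (s.card + 1),
        (s.card + 1 - d) / (s.card + 1) * esymmMean s d * f.coeff d =
      ∑ d ∈ Finset.range (s.card + 1),
        (s.card - d) / (s.card + 1) * esymmMean s (d + 1) * f.coeff (d + 1) + f.coeff 0 := by
    have h := Finset.sum_range_succ
      (fun d : ℕ => ((s.card : 𝕜) + 1 - d) / (s.card + 1) * esymmMean s d * f.coeff d) (s.card + 1)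
    rw [Finset.sum_range_succ', esymmMean_of_card_lt (Nat.lt_succ_self _), mul_zero, zero_mul,
      add_zero] at h
    rw [← h]
    push_cast at hK ⊢
    simp [esymmMean_zero, div_self hK]
  rw [polarEval_apply, polarEval_apply, Multiset.card_cons, Finset.sum_range_succ',
    Finset.sum_congr rfl fun d _ => hcoeff d, Finset.sum_add_distrib, hshift, esymmMean_zero,
    one_mul, add_right_comm, ← Finset.sum_add_distrib]
  refine congrArg (· + f.coeff 0) (Finset.sum_congr rfl fun d hd => ?_)
  rw [esymmMean_cons_succ z s (Nat.lt_succ_iff.mp (Finset.mem_range.mp hd)), add_mul]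

theorem polarEval_replicate {𝕜 : Type*} [Field 𝕜] [CharZero 𝕜] {K : ℕ} {f : 𝕜[X]}
    (hf : f.natDegree ≤ K) (z : 𝕜) : polarEval (Multiset.replicate K z) f = f.eval z := by
  induction K generalizing f with
  | zero =>
    rw [eq_C_of_natDegree_le_zero hf]
    simp [polarEval_apply, esymmMean_zero]
  | succ K ih =>
    rw [Multiset.replicate_succ, polarEval_cons, Multiset.card_replicate,
      ih (natDegree_polarDerivative_le z hf), eval_polarDerivative, sub_self, zero_mul, add_zero]

/-- The **Grace–Walsh–Szegő theorem** for a half plane. -/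
theorem polarEval_ne_zero {ω : ℂ} {c : ℝ} {s : Multiset ℂ} {f : ℂ[X]} (hf0 : f ≠ 0)
    (hf : f.natDegree ≤ s.card) (hne : ∀ z ∈ halfPlane ω c, f.eval z ≠ 0)
    (hs : ∀ z ∈ s, z ∈ halfPlane ω c) : polarEval s f ≠ 0 := by
  induction s using Multiset.induction_on generalizing f with
  | empty =>
    rw [Multiset.card_zero] at hf
    rw [← Multiset.replicate_zero (0 : ℂ), polarEval_replicate hf]
    rw [eq_C_of_natDegree_le_zero hf] at hf0 ⊢
    simpa using hf0
  | cons z s ih =>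
    rw [Multiset.card_cons] at hf
    have hz := hs z (Multiset.mem_cons_self z s)
    have hne' : ∀ w ∈ halfPlane ω c, (polarDerivative (s.card + 1) z f).eval w ≠ 0 := fun w hw =>
      polarDerivative_eval_ne_zero hf hne hz hw
    rw [polarEval_cons]
    exact ih (fun h => hne' z hz (by rw [h, eval_zero])) (natDegree_polarDerivative_le z hf) hne'
      fun w hw => hs w (Multiset.mem_cons_of_mem hw)

end GraceWalshSzego

section Hurwitz

open Polynomial

theorem norm_eval_le_of_forall_ne_zero {k : ℕ} {f : ℂ[X]} (hf : f.natDegree ≤ k)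
    (hne : ∀ z : ℂ, 0 < z.im → f.eval z ≠ 0) {z : ℂ} (hz : 0 < z.im) (w : ℂ) :
    ‖f.eval w‖ ≤ ‖f.eval z‖ * (1 + ‖w - z‖ / z.im) ^ k := by
  set M := 1 + ‖w - z‖ / z.im with hM
  have hM1 : 1 ≤ M := le_add_of_nonneg_right (by positivity)
  have hroot : ∀ r ∈ f.roots, ‖w - r‖ ≤ ‖z - r‖ * M := by
    intro r hr
    have hr0 : r.im ≤ 0 := not_lt.mp fun h => hne r h (mem_roots'.mp hr).2
    have hzr : z.im ≤ ‖z - r‖ := by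
      have := (le_abs_self _).trans (Complex.abs_im_le_norm (z - r))
      rw [Complex.sub_im] at this
      linarith
    calc ‖w - r‖ = ‖(z - r) + (w - z)‖ := by rw [add_comm, sub_add_sub_cancel]
      _ ≤ ‖z - r‖ + z.im * (‖w - z‖ / z.im) := by
          rw [mul_div_cancel₀ _ hz.ne']
          exact norm_add_le _ _
      _ ≤ ‖z - r‖ + ‖z - r‖ * (‖w - z‖ / z.im) := by gcongr
      _ = ‖z - r‖ * M := by rw [hM]; ring
  have hnorm : ∀ v, ‖f.eval v‖ = ‖f.leadingCoeff‖ * (f.roots.map fun r => ‖v - r‖).prod := by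
    intro v
    rw [(IsAlgClosed.splits f).eval_eq_prod_roots, norm_mul]
    congr 1
    exact (map_multiset_prod (normHom : ℂ →*₀ ℝ) _).trans (by rw [Multiset.map_map]; rfl)
  calc ‖f.eval w‖ = ‖f.leadingCoeff‖ * (f.roots.map fun r => ‖w - r‖).prod := hnorm w
    _ ≤ ‖f.leadingCoeff‖ * (f.roots.map fun r => ‖z - r‖ * M).prod := by
        gcongr
        exact Multiset.prod_map_le_prod_map₀ _ _ (fun _ _ => norm_nonneg _) hroot
    _ = ‖f.eval z‖ * M ^ f.roots.card := by
        rw [Multiset.prod_map_mul, Multiset.map_const', Multiset.prod_replicate, ← mul_assoc, hnorm]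
    _ ≤ ‖f.eval z‖ * M ^ k := by
        gcongr
        exact (card_roots' f).trans hf

/-- **Hurwitz's theorem** for polynomials of bounded degree and the upper half plane. -/
theorem eval_ne_zero_of_tendsto {ι : Type*} {l : Filter ι} [l.NeBot] {k : ℕ} {F : ι → ℂ[X]}
    {f : ℂ[X]} (hdeg : ∀ᶠ ε in l, (F ε).natDegree ≤ k)
    (hne : ∀ᶠ ε in l, ∀ z : ℂ, 0 < z.im → (F ε).eval z ≠ 0)
    (hlim : ∀ z, Tendsto (fun ε => (F ε).eval z) l (𝓝 (f.eval z)))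
    (hf : f ≠ 0) {z : ℂ} (hz : 0 < z.im) : f.eval z ≠ 0 := by
  intro h0
  refine hf (Polynomial.funext fun w => ?_)
  have hbound : ∀ᶠ ε in l, ‖(F ε).eval w‖ ≤ ‖(F ε).eval z‖ * (1 + ‖w - z‖ / z.im) ^ k := by
    filter_upwards [hdeg, hne] with ε hdeg hne using norm_eval_le_of_forall_ne_zero hdeg hne hz w
  have hle := le_of_tendsto_of_tendsto (hlim w).norm ((hlim z).norm.mul_const _) hbound
  rw [h0, norm_zero, zero_mul] at hle
  rw [eval_zero, norm_le_zero_iff.mp hle]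

end Hurwitz

open MvPolynomial

theorem continuous_aeval_complex {σ : Type*} (p : MvPolynomial σ ℝ) :
    Continuous fun z : σ → ℂ => aeval z p := by
  simp only [aeval_def, eval₂_eq]
  fun_prop

theorem aeval_ofReal {σ : Type*} (p : MvPolynomial σ ℝ) (v : σ → ℝ) :
    aeval (fun i => (v i : ℂ)) p = ((eval v p : ℝ) : ℂ) := by
  simpa [Function.comp_def, coe_aeval_eq_eval] using aeval_algebraMap_apply ℂ v p

theorem aeval_conj {σ : Type*} (p : MvPolynomial σ ℝ) (z : σ → ℂ) :
    aeval (fun i => starRingEnd ℂ (z i)) p = starRingEnd ℂ (aeval z p) :=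
  (comp_aeval_apply z Complex.conjAe.toAlgHom p).symm

section Polarization

variable {σ : Type*} [Fintype σ]

theorem aeval_polarization (k : ℕ) (p : MvPolynomial σ ℝ) (z : σ → Fin k → ℂ) :
    aeval (Function.uncurry z) (polarization k p) =
      ∑ m ∈ p.support,
        ((coeff m p : ℝ) : ℂ) * ∏ i, esymmMean (Finset.univ.val.map (z i)) (m i) := by
  simp only [polarization, map_sum, map_mul, map_prod, aeval_C, aeval_rename,
    aeval_esymm_eq_multiset_esymm, esymmMean]
  refine Finset.sum_congr rfl fun m _ => congrArg _ (Finset.prod_congr rfl fun i _ => ?_)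
  simp [Function.comp_def]

theorem rename_fst_polarization {k : ℕ} {p : MvPolynomial σ ℝ} (hpk : ∀ i, p.degreeOf i ≤ k) :
    rename Prod.fst (polarization k p) = p := by
  conv_rhs => rw [p.as_sum]
  rw [polarization, map_sum]
  refine Finset.sum_congr rfl fun m hm => ?_
  rw [map_mul, map_prod, rename_C, monomial_eq, Finsupp.prod_fintype _ _ fun _ => pow_zero _]
  congr 1
  refine Finset.prod_congr rfl fun i _ => ?_
  have hmi : m i ≤ k := (monomial_le_degreeOf i hm).trans (hpk i)
  have hch : (k.choose (m i) : ℝ) ≠ 0 := by exact_mod_cast (Nat.choose_pos hmi).ne'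
  rw [map_mul, rename_C, rename_rename, esymm, map_sum,
    Finset.sum_congr rfl (g := fun _ => (X i : MvPolynomial σ ℝ) ^ m i)]
  · rw [Finset.sum_const, Finset.card_powersetCard, Finset.card_univ, Fintype.card_fin,
      nsmul_eq_mul, ← mul_assoc, ← map_natCast (C : ℝ →+* MvPolynomial σ ℝ), ← C_mul,
      inv_mul_cancel₀ hch, C_1, one_mul]
  · intro t ht
    rw [map_prod]
    simp [(Finset.mem_powersetCard.mp ht).2]

theorem aeval_polarization_const {k : ℕ} {p : MvPolynomial σ ℝ} (hp : ∀ i, p.degreeOf i ≤ k)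
    (z : σ → ℂ) :
    aeval (Function.uncurry fun i (_ : Fin k) => z i) (polarization k p) = aeval z p := by
  conv_rhs => rw [← rename_fst_polarization hp, aeval_rename]
  rfl

variable [DecidableEq σ]

/-- The univariate polynomial whose polarization is the polarization of `p` as a function of the
`i`-th block of variables alone, the other blocks being fixed by `z`. -/
noncomputable def polarSlice {k : ℕ} (p : MvPolynomial σ ℝ) (z : σ → Fin k → ℂ) (i : σ) :
    Polynomial ℂ :=
  ∑ m ∈ p.support, Polynomial.C (((coeff m p : ℝ) : ℂ) *
    ∏ l ∈ Finset.univ.erase i, esymmMean (Finset.univ.val.map (z l)) (m l)) *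
      Polynomial.X ^ m i

theorem natDegree_polarSlice_le {k : ℕ} {p : MvPolynomial σ ℝ} {i : σ} (hp : p.degreeOf i ≤ k)
    (z : σ → Fin k → ℂ) : (polarSlice p z i).natDegree ≤ k :=
  Polynomial.natDegree_sum_le_of_forall_le _ _ fun _ hm =>
    (Polynomial.natDegree_C_mul_X_pow_le _ _).trans ((monomial_le_degreeOf i hm).trans hp)

theorem polarEval_polarSlice {k : ℕ} (p : MvPolynomial σ ℝ) (z : σ → Fin k → ℂ) (i : σ)
    (s : Fin k → ℂ) :
    polarEval (Finset.univ.val.map s) (polarSlice p z i) =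
      aeval (Function.uncurry (Function.update z i s)) (polarization k p) := by
  rw [aeval_polarization, polarSlice, map_sum]
  refine Finset.sum_congr rfl fun m _ => ?_
  rw [polarEval_C_mul_X_pow, ← Finset.prod_erase_mul _ _ (Finset.mem_univ i),
    Function.update_self, mul_assoc]
  congr 2
  refine Finset.prod_congr rfl fun l hl => ?_
  rw [Function.update_of_ne (Finset.ne_of_mem_erase hl)]

theorem eval_polarSlice {k : ℕ} {p : MvPolynomial σ ℝ} {i : σ} (hp : p.degreeOf i ≤ k)
    (z : σ → Fin k → ℂ) (v : ℂ) :
    (polarSlice p z i).eval v =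
      aeval (Function.uncurry (Function.update z i fun _ => v)) (polarization k p) := by
  rw [← polarEval_polarSlice, ← polarEval_replicate (natDegree_polarSlice_le hp z)]
  simp

theorem exists_halfPlane_eval_ne_zero {f : Polynomial ℂ} (hf : f ≠ 0) {a : ℝ}
    (hroots : ∀ r, f.eval r = 0 → r.re < a) : ∃ c < a, ∀ z ∈ halfPlane 1 c, f.eval z ≠ 0 := by
  have hev : ∀ᶠ c in 𝓝[<] a, ∀ r ∈ f.roots.toFinset, r.re < c :=
    (eventually_all_finset _).mpr fun r hr => mem_nhdsWithin_of_mem_nhds <|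
      lt_mem_nhds (hroots r (Polynomial.mem_roots'.mp (Multiset.mem_toFinset.mp hr)).2)
  obtain ⟨c, hc, hca⟩ := (hev.and self_mem_nhdsWithin).exists
  refine ⟨c, hca, fun z hz h0 => ?_⟩
  have hzc := hc z (Multiset.mem_toFinset.mpr ((Polynomial.mem_roots hf).mpr h0))
  rw [mem_halfPlane, one_mul] at hz
  exact lt_asymm hz hzc

theorem polarEval_map_univ_ne_zero {ω : ℂ} {c : ℝ} {k : ℕ} {f : Polynomial ℂ} (hf0 : f ≠ 0)
    (hf : f.natDegree ≤ k) (hne : ∀ z ∈ halfPlane ω c, f.eval z ≠ 0) {s : Fin k → ℂ}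
    (hs : ∀ j, s j ∈ halfPlane ω c) : polarEval (Finset.univ.val.map s) f ≠ 0 := by
  refine polarEval_ne_zero hf0 (by simpa using hf) hne fun z hz => ?_
  obtain ⟨j, -, rfl⟩ := Multiset.mem_map.mp hz
  exact hs j

omit [DecidableEq σ] in
theorem RealStable.polarization {k : ℕ} {p : MvPolynomial σ ℝ} (hp : RealStable p)
    (hpk : ∀ i, p.degreeOf i ≤ k) : RealStable (polarization k p) := by
  classical
  intro z hz
  refine forall_of_forall_update (A := fun _ => {s | ∃ v : ℂ, 0 < v.im ∧ s = fun _ => v})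
    (B := fun _ => {s : Fin k → ℂ | ∀ j, 0 < (s j).im})
    (P := fun z => aeval (Function.uncurry z) (ALS.polarization k p) ≠ 0)
    ?_ (fun z hz => ?_) (fun i z hz hne => ?_) (Function.curry z) fun i j => hz (i, j)
  · rintro _ _ ⟨v, hv, rfl⟩ _
    exact hv
  · choose w hw hzw using hz
    obtain rfl : z = fun i _ => w i := funext hzw
    rw [aeval_polarization_const hpk]
    exact hp w hw
  · have hslice : ∀ v : ℂ, 0 < v.im → (polarSlice p z i).eval v ≠ 0 := fun v hv => by
      rw [eval_polarSlice (hpk i)]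
      exact hne _ ⟨v, hv, rfl⟩
    rw [← Function.update_eq_self i z, ← polarEval_polarSlice]
    refine polarEval_map_univ_ne_zero (ω := -Complex.I) (c := 0) (fun h => ?_)
      (natDegree_polarSlice_le (hpk i) z) (fun v hv => hslice v (by simpa [mem_halfPlane] using hv))
      fun j => by simpa [mem_halfPlane] using hz i j
    exact hslice Complex.I (by simp) (by rw [h, Polynomial.eval_zero])

theorem eval_polarSlice_conj {k : ℕ} {p : MvPolynomial σ ℝ} {i : σ} (hp : p.degreeOf i ≤ k)
    (x : σ → Fin k → ℝ) (v : ℂ) :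
    (polarSlice p (fun l j => (x l j : ℂ)) i).eval (starRingEnd ℂ v) =
      starRingEnd ℂ ((polarSlice p (fun l j => (x l j : ℂ)) i).eval v) := by
  rw [eval_polarSlice hp, eval_polarSlice hp, ← aeval_conj]
  congr 2
  funext ⟨l, j⟩
  rcases eq_or_ne l i with rfl | h <;> simp [Function.uncurry, *]

theorem polarEval_polarSlice_ofReal {k : ℕ} (p : MvPolynomial σ ℝ) (x : σ → Fin k → ℝ) (i : σ)
    (s : Fin k → ℝ) :
    polarEval (Finset.univ.val.map fun j => (s j : ℂ)) (polarSlice p (fun l j => (x l j : ℂ)) i) =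
      ((eval (Function.uncurry (Function.update x i s)) (polarization k p) : ℝ) : ℂ) := by
  rw [polarEval_polarSlice, ← aeval_ofReal]
  congr 2
  funext ⟨l, j⟩
  rcases eq_or_ne l i with rfl | h <;> simp [Function.uncurry, *]

theorem eval_polarSlice_ofReal {k : ℕ} {p : MvPolynomial σ ℝ} {i : σ} (hp : p.degreeOf i ≤ k)
    (x : σ → Fin k → ℝ) (v : ℝ) :
    (polarSlice p (fun l j => (x l j : ℂ)) i).eval (v : ℂ) =
      ((eval (Function.uncurry (Function.update x i fun _ => v)) (polarization k p) : ℝ) : ℂ) := by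
  rw [eval_polarSlice hp, ← polarEval_polarSlice, polarEval_polarSlice_ofReal]

theorem RealStable.eval_polarSlice_ne_zero {k : ℕ} {p : MvPolynomial σ ℝ} (hp : RealStable p)
    (hpk : ∀ i, p.degreeOf i ≤ k) (x : σ → Fin k → ℝ) (i : σ)
    (h0 : polarSlice p (fun l j => (x l j : ℂ)) i ≠ 0) {v : ℂ} (hv : v.im ≠ 0) :
    (polarSlice p (fun l j => (x l j : ℂ)) i).eval v ≠ 0 := by
  wlog hpos : 0 < v.im generalizing v
  · rw [← Complex.conj_conj v, eval_polarSlice_conj (hpk i), Ne, map_eq_zero]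
    have hneg : v.im < 0 := hv.lt_of_le (not_lt.mp hpos)
    exact this (by simpa using hv) (by simpa using hneg)
  let shift : ℝ → σ → Fin k → ℂ := fun ε l j => x l j + ε * Complex.I
  have hshift : Continuous shift := by fun_prop
  refine eval_ne_zero_of_tendsto (l := 𝓝[>] (0 : ℝ)) (F := fun ε => polarSlice p (shift ε) i)
    (Eventually.of_forall fun ε => natDegree_polarSlice_le (hpk i) _) ?_ (fun w => ?_) h0 hpos
  · filter_upwards [self_mem_nhdsWithin] with ε hε w hw
    rw [eval_polarSlice (hpk i)]
    refine hp.polarization hpk _ fun ⟨l, j⟩ => ?_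
    rcases eq_or_ne l i with rfl | h
    · simpa [Function.uncurry] using hw
    · simpa [Function.uncurry, h, shift] using hε
  · simp only [eval_polarSlice (hpk i)]
    have hcont : Continuous fun ε => Function.uncurry (Function.update (shift ε) i fun _ => w) :=
      continuous_pi fun e => (continuous_apply_apply e.1 e.2).comp
        (hshift.update i continuous_const)
    have hlim := ((continuous_aeval_complex (ALS.polarization k p)).comp hcont).tendsto 0
    simpa [Function.comp_def, shift] using hlim.mono_left nhdsWithin_le_nhds

omit [DecidableEq σ] in
theorem AboveRoots.polarization {k : ℕ} {p : MvPolynomial σ ℝ} {a : σ → ℝ} (ha : AboveRoots a p)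
    (hp : RealStable p) (hpk : ∀ i, p.degreeOf i ≤ k) :
    AboveRoots (repeated k a) (polarization k p) := by
  classical
  intro t ht
  refine forall_of_forall_update (A := fun i => {s | ∃ v : ℝ, a i ≤ v ∧ s = fun _ => v})
    (B := fun i => {s : Fin k → ℝ | ∀ j, a i ≤ s j})
    (P := fun x => eval (Function.uncurry x) (ALS.polarization k p) ≠ 0)
    ?_ (fun x hx => ?_) (fun i x hx hne => ?_) (Function.curry (repeated k a + t))
    fun i j => le_add_of_nonneg_right (ht (i, j))
  · rintro _ _ ⟨v, hv, rfl⟩ _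
    exact hv
  · choose w hw hxw using hx
    obtain rfl : x = fun i _ => w i := funext hxw
    rw [← Complex.ofReal_ne_zero, ← aeval_ofReal]
    have haw := ha (w - a) fun i => sub_nonneg.mpr (hw i)
    rw [add_sub_cancel, ← Complex.ofReal_ne_zero, ← aeval_ofReal, ← aeval_polarization_const hpk]
      at haw
    exact haw
  · set f := polarSlice p (fun l j => (x l j : ℂ)) i
    have hreal : ∀ v : ℝ, a i ≤ v → f.eval (v : ℂ) ≠ 0 := fun v hv => by
      rw [eval_polarSlice_ofReal (hpk i), Complex.ofReal_ne_zero]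
      exact hne _ ⟨v, hv, rfl⟩
    have hf0 : f ≠ 0 := fun h => hreal (a i) le_rfl (by rw [h, Polynomial.eval_zero])
    have hroots : ∀ r, f.eval r = 0 → r.re < a i := by
      intro r hr
      have him : r.im = 0 := by_contra fun h => hp.eval_polarSlice_ne_zero hpk x i hf0 h hr
      refine not_le.mp fun h => hreal r.re h ?_
      rwa [show (r.re : ℂ) = r from Complex.ext rfl him.symm]
    obtain ⟨c, hca, hc⟩ := exists_halfPlane_eval_ne_zero hf0 hroots
    rw [← Function.update_eq_self i x, ← Complex.ofReal_ne_zero, ← polarEval_polarSlice_ofReal]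
    exact polarEval_map_univ_ne_zero hf0 (natDegree_polarSlice_le (hpk i) _) hc fun j => by
      simpa [mem_halfPlane] using hca.trans_le (hx i j)

end Polarization

section Multiaffine

variable {σ R A : Type*} [CommRing R] [CommRing A] [Algebra R A]

theorem degreeOf_pderiv_le (i j : σ) (p : MvPolynomial σ R) :
    (pderiv j p).degreeOf i ≤ p.degreeOf i := by
  refine degreeOf_le_iff.mpr fun m hm => ?_
  rw [mem_support_iff, coeff_pderiv] at hm
  have hle := monomial_le_degreeOf i (mem_support_iff.mpr (left_ne_zero_of_mul hm))
  exact (Nat.le_add_right _ _).trans hle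

theorem degreeOf_pderiv_self_le (i : σ) (p : MvPolynomial σ R) :
    (pderiv i p).degreeOf i ≤ p.degreeOf i - 1 := by
  refine degreeOf_le_iff.mpr fun m hm => ?_
  rw [mem_support_iff, coeff_pderiv] at hm
  have hle := monomial_le_degreeOf i (mem_support_iff.mpr (left_ne_zero_of_mul hm))
  rw [Finsupp.add_apply, Finsupp.single_eq_same] at hle
  exact Nat.le_sub_one_of_lt hle

theorem degreeOf_eq_zero_iff_notMem_vars {p : MvPolynomial σ R} {i : σ} :
    p.degreeOf i = 0 ↔ i ∉ p.vars := by
  classical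
  rw [vars_def, Multiset.mem_toFinset, ← Multiset.count_eq_zero, ← degreeOf_def]

theorem pderiv_pderiv_self {p : MvPolynomial σ R} {i : σ} (h : p.degreeOf i ≤ 1) :
    pderiv i (pderiv i p) = 0 :=
  pderiv_eq_zero_of_notMem_vars <| degreeOf_eq_zero_iff_notMem_vars.mp <|
    Nat.le_zero.mp <| (degreeOf_pderiv_self_le i p).trans (Nat.sub_le_sub_right h 1)

theorem degreeOf_sub_X_mul_pderiv {p : MvPolynomial σ R} {i : σ} (h : p.degreeOf i ≤ 1) :
    (p - X i * pderiv i p).degreeOf i = 0 := by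
  classical
  refine Nat.le_zero.mp <| degreeOf_le_iff.mpr fun m hm => ?_
  have hcoeff : coeff m (X i * pderiv i p) = m i * coeff m p := by
    rw [coeff_X_mul']
    split_ifs with hi
    · have hle : Finsupp.single i 1 ≤ m :=
        Finsupp.single_le_iff.mpr (Nat.one_le_iff_ne_zero.mpr (Finsupp.mem_support_iff.mp hi))
      have hmi : (m - Finsupp.single i 1 : σ →₀ ℕ) i + 1 = m i := by
        simpa using Nat.sub_add_cancel (Finsupp.single_le_iff.mp hle)
      rw [coeff_pderiv, tsub_add_cancel_of_le hle, ← Nat.cast_add_one, hmi, mul_comm]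
    · rw [Finsupp.notMem_support_iff.mp hi, Nat.cast_zero, zero_mul]
  rw [mem_support_iff, coeff_sub, hcoeff] at hm
  have hmp : coeff m p ≠ 0 := fun h0 => hm (by rw [h0, mul_zero, sub_zero])
  refine Nat.le_zero.mpr <| (Nat.le_one_iff_eq_zero_or_eq_one.mp <|
    (monomial_le_degreeOf i (mem_support_iff.mpr hmp)).trans h).resolve_right fun h1 => hm ?_
  rw [h1, Nat.cast_one, one_mul, sub_self]

variable [DecidableEq σ]

theorem aeval_add_single_of_degreeOf_eq_zero {p : MvPolynomial σ R} {i : σ}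
    (h : p.degreeOf i = 0) (z : σ → A) (t : A) : aeval (z + Pi.single i t) p = aeval z p := by
  refine hom_congr_vars (by ext; simp) (fun l hl _ => ?_) rfl
  have hli : l ≠ i := fun hli => degreeOf_eq_zero_iff_notMem_vars.mp h (hli ▸ hl)
  simp [hli]

theorem aeval_add_single {p : MvPolynomial σ R} {i : σ} (h : p.degreeOf i ≤ 1) (z : σ → A)
    (t : A) : aeval (z + Pi.single i t) p = aeval z p + t * aeval z (pderiv i p) := by
  have hpderiv : (pderiv i p).degreeOf i = 0 :=
    Nat.le_zero.mp <| (degreeOf_pderiv_self_le i p).trans (Nat.sub_le_sub_right h 1)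
  have hrest := aeval_add_single_of_degreeOf_eq_zero (degreeOf_sub_X_mul_pderiv h) z t
  simp only [map_sub, map_mul, aeval_X, aeval_add_single_of_degreeOf_eq_zero hpderiv, Pi.add_apply,
    Pi.single_eq_same] at hrest
  linear_combination hrest

theorem eval_add_single {p : MvPolynomial σ R} {i : σ} (h : p.degreeOf i ≤ 1) (x : σ → R)
    (t : R) : eval (x + Pi.single i t) p = eval x p + t * eval x (pderiv i p) := by
  simpa only [← coe_aeval_eq_eval, RingHom.coe_coe] using aeval_add_single h x t

omit [DecidableEq σ] in
theorem pderiv_pderiv_comm (i j : σ) (p : MvPolynomial σ ℝ) :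
    pderiv i (pderiv j p) = pderiv j (pderiv i p) :=
  LinearMap.congr_fun (partialD_commute i j) p

omit [DecidableEq σ] in
theorem Multiaffine.pderiv {p : MvPolynomial σ ℝ} (hp : Multiaffine p) (j : σ) :
    Multiaffine (pderiv j p) :=
  fun i => (degreeOf_pderiv_le i j p).trans (hp i)

omit [DecidableEq σ] in
theorem Multiaffine.add {p q : MvPolynomial σ ℝ} (hp : Multiaffine p) (hq : Multiaffine q) :
    Multiaffine (p + q) :=
  fun i => (degreeOf_add_le i p q).trans (max_le (hp i) (hq i))

end Multiaffine

section Stability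

variable {σ : Type*}

theorem eq_zero_of_aeval_complex_eq_zero {p : MvPolynomial σ ℝ} {s : σ → Set ℂ}
    (hs : ∀ i, (s i).Infinite) (h : ∀ z, (∀ i, z i ∈ s i) → aeval z p = 0) : p = 0 := by
  refine (map_eq_zero_iff _ (map_injective _ (algebraMap ℝ ℂ).injective)).mp ?_
  refine funext_set s hs fun z hz => ?_
  rw [map_zero, eval_map, ← aeval_def]
  exact h z fun i => hz i (Set.mem_univ i)

section Line

variable {R A : Type*} [CommRing R] [CommRing A] [Algebra R A]

/-- The restriction `s ↦ p (u + s w)` of `p` to a line, as a univariate polynomial. -/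
noncomputable def restrictLine (u w : σ → A) (p : MvPolynomial σ R) : Polynomial A :=
  aeval (fun i => Polynomial.C (u i) + Polynomial.C (w i) * Polynomial.X) p

theorem eval_restrictLine (u w : σ → A) (p : MvPolynomial σ R) (s : A) :
    (restrictLine u w p).eval s = aeval (fun i => u i + w i * s) p := by
  rw [restrictLine, ← Polynomial.coe_evalRingHom, map_aeval, aeval_def, ← coe_eval₂Hom]
  congr 1
  refine ringHom_ext (fun r => ?_) fun i => ?_ <;> simp

theorem natDegree_restrictLine_le (u w : σ → A) (p : MvPolynomial σ R) :
    (restrictLine u w p).natDegree ≤ p.totalDegree := by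
  rw [restrictLine, ← aeval_map_algebraMap A]
  exact (aeval_natDegree_le _ (Finset.sup_mono (support_map_subset _ _)) _
    fun i => by compute_degree).trans_eq (mul_one _)

end Line

/-- The multivariate **Hurwitz theorem**. A zero `z` of the limit `f` propagates to all points
`z - i w` with `0 < w ≤ Im z`, by the univariate theorem on the line through `z` in direction
`w`. -/
theorem RealStable.of_tendsto {ι : Type*} {l : Filter ι} [l.NeBot] {d : ℕ}
    {F : ι → MvPolynomial σ ℝ} {f : MvPolynomial σ ℝ} (hdeg : ∀ᶠ ε in l, (F ε).totalDegree ≤ d)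
    (hF : ∀ᶠ ε in l, RealStable (F ε))
    (hlim : ∀ z : σ → ℂ, Tendsto (fun ε => aeval z (F ε)) l (𝓝 (aeval z f))) (hf : f ≠ 0) :
    RealStable f := by
  intro z hz h0
  refine hf <| eq_zero_of_aeval_complex_eq_zero
    (s := fun i => (fun w : ℝ => z i - w * Complex.I) '' Set.Ioc 0 (z i).im) (fun i => ?_)
    fun u hu => ?_
  · exact (Set.Ioc_infinite (hz i)).image fun _ _ _ _ h => by simpa using h
  choose w hw hwu using hu
  have hf0 : restrictLine u (fun i => w i) f = 0 := by
    by_contra hne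
    refine eval_ne_zero_of_tendsto (l := l) (F := fun ε => restrictLine u (fun i => w i) (F ε))
      (k := d) ?_ ?_ (fun s => ?_) hne (z := Complex.I) (by simp) ?_
    · filter_upwards [hdeg] with ε hε
      exact (natDegree_restrictLine_le u _ _).trans hε
    · filter_upwards [hF] with ε hε s hs
      rw [eval_restrictLine]
      refine hε _ fun i => ?_
      have hmul : 0 < w i * s.im := mul_pos (hw i).1 hs
      have him : 0 ≤ (z i).im - w i := sub_nonneg.mpr (hw i).2
      simpa [← hwu i] using add_pos_of_nonneg_of_pos him hmul
    · simpa only [eval_restrictLine] using hlim _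
    · rw [eval_restrictLine, ← h0]
      congr 2
      funext i
      rw [← hwu i, sub_add_cancel]
  simpa [hf0] using (eval_restrictLine u (fun i => w i) f 0).symm

section Multiaffine

variable {p : MvPolynomial σ ℝ} (hp : RealStable p) (hp1 : Multiaffine p)
include hp hp1

theorem RealStable.im_pderiv_mul_conj_neg_or_eq_zero (i : σ) {z : σ → ℂ} (hz : ∀ l, 0 < (z l).im) :
    (aeval z (pderiv i p) * starRingEnd ℂ (aeval z p)).im < 0 ∨ aeval z (pderiv i p) = 0 := by
  classical
  by_contra! h
  obtain ⟨him, hB⟩ := h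
  set A := aeval z p
  set B := aeval z (pderiv i p) with hBdef
  have hroot : 0 ≤ (-A / B).im := by
    have heq : (-A / B).im = (B * starRingEnd ℂ A).im / Complex.normSq B := by
      simp only [Complex.div_im, Complex.mul_im, Complex.conj_re, Complex.conj_im, Complex.neg_re,
        Complex.neg_im]
      ring
    rw [heq]
    exact div_nonneg him (Complex.normSq_nonneg B)
  refine hp (z + Pi.single i (-A / B)) (fun l => ?_) ?_
  · rcases eq_or_ne l i with rfl | h
    · simpa using add_pos_of_pos_of_nonneg (hz l) hroot
    · simpa [h] using hz l
  · rw [aeval_add_single (hp1 i), ← hBdef, div_mul_cancel₀ _ hB, add_neg_cancel]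

theorem RealStable.im_pderiv_mul_conj_nonpos (i : σ) {z : σ → ℂ} (hz : ∀ l, 0 ≤ (z l).im) :
    (aeval z (pderiv i p) * starRingEnd ℂ (aeval z p)).im ≤ 0 := by
  let shift : ℝ → σ → ℂ := fun ε l => z l + ε * Complex.I
  have hshift : Continuous shift := by fun_prop
  have hcont : Continuous fun ε =>
      (aeval (shift ε) (pderiv i p) * starRingEnd ℂ (aeval (shift ε) p)).im :=
    Complex.continuous_im.comp (((continuous_aeval_complex _).comp hshift).mul
      (Complex.continuous_conj.comp ((continuous_aeval_complex _).comp hshift)))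
  have hle : ∀ᶠ ε in 𝓝[>] (0 : ℝ),
      (aeval (shift ε) (pderiv i p) * starRingEnd ℂ (aeval (shift ε) p)).im ≤ 0 := by
    filter_upwards [self_mem_nhdsWithin] with ε hε
    have hpos : ∀ l, 0 < (shift ε l).im := fun l => by
      simpa [shift] using add_pos_of_nonneg_of_pos (hz l) hε
    rcases hp.im_pderiv_mul_conj_neg_or_eq_zero hp1 i hpos with h | h
    · exact h.le
    · simp [h]
  simpa [shift] using le_of_tendsto ((hcont.tendsto 0).mono_left nhdsWithin_le_nhds) hle

/-- The **Rayleigh inequality** of a real stable polynomial. -/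
theorem RealStable.eval_mul_eval_pderiv_pderiv_le (i j : σ) (x : σ → ℝ) :
    eval x p * eval x (pderiv j (pderiv i p)) ≤ eval x (pderiv i p) * eval x (pderiv j p) := by
  classical
  have h := hp.im_pderiv_mul_conj_nonpos hp1 i (z := (fun l => (x l : ℂ)) + Pi.single j Complex.I)
    fun l => by rcases eq_or_ne l j with rfl | h <;> simp [*]
  simp only [aeval_add_single (hp1 j), aeval_add_single (hp1.pderiv i j), aeval_ofReal] at h
  simp only [map_add, Complex.conj_ofReal, map_mul, Complex.conj_I, neg_mul, Complex.mul_im,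
    Complex.add_re, Complex.ofReal_re, Complex.mul_re, Complex.I_re, zero_mul, Complex.I_im,
    Complex.ofReal_im, mul_zero, sub_self, add_zero, Complex.add_im, Complex.neg_im, one_mul,
    zero_add, mul_neg, Complex.neg_re, neg_zero] at h
  linarith

theorem RealStable.pderiv_of_ne_zero {i : σ} (h0 : pderiv i p ≠ 0) : RealStable (pderiv i p) := by
  classical
  refine RealStable.of_tendsto (l := 𝓝[>] (0 : ℝ)) (d := max p.totalDegree
    (pderiv i p).totalDegree) (F := fun ε => pderiv i p + C ε * p)
    (Eventually.of_forall fun ε => ?_) ?_ (fun z => ?_) h0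
  · rw [max_comm]
    exact (totalDegree_add _ _).trans <| max_le_max le_rfl <|
      (totalDegree_mul _ _).trans_eq (by rw [totalDegree_C, zero_add])
  · filter_upwards [self_mem_nhdsWithin] with ε hε z hz
    have hε0 : (ε : ℂ) ≠ 0 := Complex.ofReal_ne_zero.mpr (ne_of_gt hε)
    have hshift : ∀ l, 0 < ((z + Pi.single i (ε⁻¹ : ℂ) : σ → ℂ) l).im := fun l => by
      rcases eq_or_ne l i with rfl | h <;> simp [← Complex.ofReal_inv, *]
    have heq : aeval z (pderiv i p + C ε * p) =
        ε * aeval (z + Pi.single i (ε⁻¹ : ℂ)) p := by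
      rw [aeval_add_single (hp1 i), mul_add, mul_inv_cancel_left₀ hε0, map_add, map_mul, aeval_C]
      exact add_comm _ _
    rw [heq]
    exact mul_ne_zero hε0 (hp _ hshift)
  · have hcont : Continuous fun ε : ℝ => aeval z (pderiv i p) + ε * aeval z p := by
      fun_prop
    simpa using (hcont.tendsto 0).mono_left nhdsWithin_le_nhds

theorem RealStable.pderiv_add_pderiv {i j : σ} (h0 : pderiv i p + pderiv j p ≠ 0) :
    RealStable (pderiv i p + pderiv j p) := by
  intro z hz hsum
  rw [map_add] at hsum
  have him := congrArg (fun s => (s * starRingEnd ℂ (aeval z p)).im) hsum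
  simp only [add_mul, Complex.add_im, zero_mul, Complex.zero_im] at him
  have hi := hp.im_pderiv_mul_conj_nonpos hp1 i fun l => (hz l).le
  have hj := hp.im_pderiv_mul_conj_nonpos hp1 j fun l => (hz l).le
  have hvanish : ∀ e, 0 ≤ (aeval z (pderiv e p) * starRingEnd ℂ (aeval z p)).im →
      pderiv e p = 0 := fun e he => by
    by_contra hne
    exact hp.pderiv_of_ne_zero hp1 hne z hz
      ((hp.im_pderiv_mul_conj_neg_or_eq_zero hp1 e hz).resolve_left (not_lt.mpr he))
  exact h0 (by rw [hvanish i (by linarith), hvanish j (by linarith), add_zero])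

end Multiaffine

end Stability

section Barrier

variable {σ : Type*}

theorem AboveRoots.eval_ne_zero {v : σ → ℝ} {p : MvPolynomial σ ℝ} (h : AboveRoots v p) :
    eval v p ≠ 0 := by
  simpa using h 0 fun _ => le_rfl

theorem AboveRoots.mono {v u : σ → ℝ} {p : MvPolynomial σ ℝ} (h : AboveRoots v p) (hvu : v ≤ u) :
    AboveRoots u p := fun t ht => by
  rw [← add_sub_cancel v u, add_assoc]
  exact h _ fun i => add_nonneg (sub_nonneg.mpr (hvu i)) (ht i)

/-- The second logarithmic derivative `∂ᵢ∂ⱼ log p` at `v`. -/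
noncomputable def logHessian (i j : σ) (p : MvPolynomial σ ℝ) (v : σ → ℝ) : ℝ :=
  eval v (pderiv i (pderiv j p)) / eval v p - potential i p v * potential j p v

/-- The third logarithmic derivative `∂ᵢ∂ⱼ∂ₗ log p` at `v`. -/
noncomputable def logThird (i j l : σ) (p : MvPolynomial σ ℝ) (v : σ → ℝ) : ℝ :=
  eval v (pderiv i (pderiv j (pderiv l p))) / eval v p
    - potential i p v * (eval v (pderiv j (pderiv l p)) / eval v p)
    - potential j p v * (eval v (pderiv i (pderiv l p)) / eval v p)
    - potential l p v * (eval v (pderiv i (pderiv j p)) / eval v p)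
    + 2 * potential i p v * potential j p v * potential l p v

theorem RealStable.logHessian_nonpos {p : MvPolynomial σ ℝ} (hp : RealStable p)
    (hp1 : Multiaffine p) {v : σ → ℝ} (h0 : eval v p ≠ 0) (i j : σ) : logHessian i j p v ≤ 0 := by
  have heq : logHessian i j p v = (eval v p * eval v (pderiv i (pderiv j p))
      - eval v (pderiv j p) * eval v (pderiv i p)) / eval v p ^ 2 := by
    rw [logHessian, potential, potential]
    field_simp
  rw [heq]
  exact div_nonpos_of_nonpos_of_nonneg
    (sub_nonpos.mpr (hp.eval_mul_eval_pderiv_pderiv_le hp1 j i v)) (sq_nonneg _)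

/-- Rayleigh's inequality in the directions `x`, `y` holds along the whole line `v + s e_w`, where
it says that a quadratic polynomial in `s` is nonnegative. The discriminant of this quadratic is
Cayley's hyperdeterminant of the eight derivatives of `p` in the directions `x`, `y`, `w`, and
equals `p(v)⁴` times the difference of the two sides. -/
theorem RealStable.logThird_sq_le {p : MvPolynomial σ ℝ} (hp : RealStable p)
    (hp1 : Multiaffine p) {v : σ → ℝ} (h0 : eval v p ≠ 0) (x y w : σ) :
    logThird w x y p v ^ 2 ≤
      -4 * logHessian x y p v * logHessian w x p v * logHessian w y p v := by
  classical
  have hrayleigh : ∀ s : ℝ,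
      0 ≤ (eval v (pderiv w (pderiv x p)) * eval v (pderiv w (pderiv y p))
          - eval v (pderiv w p) * eval v (pderiv w (pderiv x (pderiv y p)))) * (s * s)
        + (eval v (pderiv x p) * eval v (pderiv w (pderiv y p))
          + eval v (pderiv w (pderiv x p)) * eval v (pderiv y p)
          - eval v p * eval v (pderiv w (pderiv x (pderiv y p)))
          - eval v (pderiv w p) * eval v (pderiv x (pderiv y p))) * s
        + (eval v (pderiv x p) * eval v (pderiv y p)
          - eval v p * eval v (pderiv x (pderiv y p))) := fun s => by
    have h := hp.eval_mul_eval_pderiv_pderiv_le hp1 y x (v + Pi.single w s)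
    rw [eval_add_single (hp1 w), eval_add_single (hp1.pderiv x w),
      eval_add_single (hp1.pderiv y w), eval_add_single ((hp1.pderiv y).pderiv x w)] at h
    linarith
  have hdisc := discrim_le_zero hrayleigh
  rw [← sub_nonpos]
  refine nonpos_of_mul_nonpos_right (hdisc.trans_eq' ?_) (by positivity : 0 < eval v p ^ 4)
  simp only [discrim, logThird, logHessian, potential]
  field_simp
  ring

variable {p : MvPolynomial σ ℝ} {v : σ → ℝ}

theorem potential_nonneg (hp1 : Multiaffine p) (h : AboveRoots v p) (i : σ) :
    0 ≤ potential i p v := by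
  classical
  by_contra! hneg
  have hs : (0 : σ → ℝ) ≤ Pi.single i (-(potential i p v)⁻¹) :=
    Pi.single_nonneg.mpr (neg_nonneg.mpr (inv_nonpos.mpr hneg.le))
  refine h _ hs ?_
  have hB : eval v (pderiv i p) ≠ 0 := fun hB => hneg.ne (by rw [potential, hB, zero_div])
  rw [eval_add_single (hp1 i), potential, inv_div, neg_mul, div_mul_cancel₀ _ hB, add_neg_cancel]

theorem potential_add_single [DecidableEq σ] (hp1 : Multiaffine p) (h0 : eval v p ≠ 0) (i j : σ)
    (s : ℝ) :
    potential i p (v + Pi.single j s) =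
      (potential i p v + s * (eval v (pderiv j (pderiv i p)) / eval v p)) /
        (1 + s * potential j p v) := by
  rw [potential, eval_add_single (hp1 j), eval_add_single (hp1.pderiv i j), potential, potential,
    ← mul_div_mul_left _ (1 + s * (eval v (pderiv j p) / eval v p)) h0]
  congr 1 <;> field_simp

theorem eval_pderiv_pderiv_div_nonneg (hp1 : Multiaffine p) (h : AboveRoots v p) (i j : σ) :
    0 ≤ eval v (pderiv j (pderiv i p)) / eval v p := by
  classical
  by_contra! hneg
  set d := eval v (pderiv j (pderiv i p)) / eval v p
  have hb := potential_nonneg hp1 h i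
  have hc := potential_nonneg hp1 h j
  obtain ⟨s, hs, hsd⟩ : ∃ s, 0 ≤ s ∧ potential i p v + s * d < 0 := by
    refine ⟨(potential i p v + 1) / -d, div_nonneg (by linarith) (by linarith), ?_⟩
    rw [div_neg, neg_mul, div_mul_cancel₀ _ hneg.ne]
    linarith
  have hle : v ≤ v + Pi.single j s := le_add_of_nonneg_right (Pi.single_nonneg.mpr hs)
  refine (potential_nonneg hp1 (h.mono hle) i).not_gt ?_
  rw [potential_add_single hp1 h.eval_ne_zero i j]
  exact div_neg_of_neg_of_pos hsd (by positivity)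

theorem potential_add_single_le [DecidableEq σ] (hp : RealStable p) (hp1 : Multiaffine p)
    (h : AboveRoots v p) (i j : σ) {s : ℝ} (hs : 0 ≤ s) :
    potential i p (v + Pi.single j s) ≤ potential i p v := by
  have hc := potential_nonneg hp1 h j
  have hd := mul_nonneg hs (neg_nonneg.mpr (hp.logHessian_nonpos hp1 h.eval_ne_zero j i))
  rw [potential_add_single hp1 h.eval_ne_zero, div_le_iff₀ (by positivity)]
  rw [logHessian] at hd
  linarith

theorem potential_le_of_le [Finite σ] (hp : RealStable p) (hp1 : Multiaffine p)
    (h : AboveRoots v p) {u : σ → ℝ} (hvu : v ≤ u) (i : σ) :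
    potential i p u ≤ potential i p v := by
  classical
  refine forall_of_forall_update (A := fun l => {v l}) (B := fun l => Set.Ici (v l))
    (P := fun u => potential i p u ≤ potential i p v) (fun l => ?_) (fun u hu => ?_)
    (fun l u hu hle => ?_) u hvu
  · exact Set.singleton_subset_iff.mpr Set.self_mem_Ici
  · rw [funext hu]
  · have habove : AboveRoots (Function.update u l (v l)) p :=
      h.mono (le_update_iff.mpr ⟨le_rfl, fun e _ => hu e⟩)
    have hsplit : u = Function.update u l (v l) + Pi.single l (u l - v l) := by
      ext e
      rcases eq_or_ne e l with rfl | he <;> simp [*]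
    rw [hsplit]
    exact (potential_add_single_le hp hp1 habove i l (sub_nonneg.mpr (hu l))).trans
      (hle _ (Set.mem_singleton _))

theorem potential_add_potential_pos [Finite σ] (hp : RealStable p) (hp1 : Multiaffine p)
    (h : AboveRoots v p) {x y : σ} (hxy : pderiv x p + pderiv y p ≠ 0) :
    0 < potential x p v + potential y p v := by
  by_contra! hle
  refine hxy (funext_set (fun i => Set.Ici (v i)) (fun i => Set.Ici_infinite _) fun u hu => ?_)
  have hvu : v ≤ u := fun i => hu i (Set.mem_univ i)
  have hu := h.mono hvu
  have hzero : ∀ i, potential i p v ≤ 0 → eval u (pderiv i p) = 0 := fun i hi =>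
    (div_eq_zero_iff.mp <| le_antisymm ((potential_le_of_le hp hp1 h hvu i).trans hi)
      (potential_nonneg hp1 hu i)).resolve_right hu.eval_ne_zero
  have hx := potential_nonneg hp1 h x
  have hy := potential_nonneg hp1 h y
  rw [map_add, hzero x (by linarith), hzero y (by linarith), add_zero, map_zero]

theorem add_sub_mul_pos {b c d δ : ℝ} (hb : 0 ≤ b) (hc : 0 ≤ c) (hbc : 0 < b + c)
    (hd : d ≤ b * c) (hδ : 0 ≤ δ) (hδ1 : δ * (b + c) ≤ 1) : 0 < b + c - δ * d := by
  have hlt : δ * (b * c) * (b + c) < (b + c) * (b + c) :=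
    calc δ * (b * c) * (b + c) = δ * (b + c) * (b * c) := by ring
      _ ≤ 1 * (b * c) := mul_le_mul_of_nonneg_right hδ1 (mul_nonneg hb hc)
      _ < (b + c) * (b + c) := by nlinarith
  have hle := mul_le_mul_of_nonneg_left hd hδ
  linarith [lt_of_mul_lt_mul_right hlt hbc.le]

theorem mul_add_mul_le_of_sq_le {b c α β γ τ δ : ℝ} (hb : 0 ≤ b) (hc : 0 ≤ c) (hβ : 0 ≤ β)
    (hγ : 0 ≤ γ) (hα : α ≤ b * c) (hτ : τ ^ 2 ≤ 4 * α * β * γ) (hδ : 0 ≤ δ)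
    (hδ1 : δ * (b + c) ≤ 1) : δ * (β * c + γ * b) ≤ β + γ + δ * τ := by
  have hsq : τ ^ 2 ≤ (β * b + γ * c) ^ 2 := by
    have := mul_le_mul_of_nonneg_right hα (mul_nonneg hβ hγ)
    nlinarith [sq_nonneg (β * b - γ * c)]
  have hτ' := (abs_le.mp (abs_le_of_sq_le_sq hsq (by positivity))).1
  calc δ * (β * c + γ * b) ≤ δ * (β * c + γ * b) + δ * (β * b + γ * c + τ) :=
        le_add_of_nonneg_right (mul_nonneg hδ (by linarith))
    _ = δ * (b + c) * (β + γ) + δ * τ := by ring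
    _ ≤ 1 * (β + γ) + δ * τ := by gcongr
    _ = β + γ + δ * τ := by ring

variable [DecidableEq σ]

theorem eval_pderiv_add_pderiv_sub_single (hp1 : Multiaffine p) (x y : σ) (v : σ → ℝ) (δ : ℝ) :
    eval (v - Pi.single x δ) (pderiv x p + pderiv y p) =
      eval v (pderiv x p) + eval v (pderiv y p) - δ * eval v (pderiv x (pderiv y p)) := by
  rw [sub_eq_add_neg, ← Pi.single_neg, eval_add_single ((hp1.pderiv x).add (hp1.pderiv y) x),
    map_add, map_add, pderiv_pderiv_self (hp1 x), zero_add]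
  ring

theorem eval_pderiv_add_pderiv_sub_single_ne_zero [Finite σ] (hp : RealStable p)
    (hp1 : Multiaffine p) (h : AboveRoots v p) {x y : σ} (hxy : pderiv x p + pderiv y p ≠ 0) {δ : ℝ}
    (hδ : 0 ≤ δ) (hδ1 : δ * (potential x p v + potential y p v) ≤ 1) :
    eval (v - Pi.single x δ) (pderiv x p + pderiv y p) ≠ 0 := by
  have h0 := h.eval_ne_zero
  have heq : eval (v - Pi.single x δ) (pderiv x p + pderiv y p) = eval v p *
      (potential x p v + potential y p v - δ * (eval v (pderiv x (pderiv y p)) / eval v p)) := by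
    rw [eval_pderiv_add_pderiv_sub_single hp1, potential, potential]
    field_simp
  rw [heq]
  exact mul_ne_zero h0 (add_sub_mul_pos (potential_nonneg hp1 h x) (potential_nonneg hp1 h y)
    (potential_add_potential_pos hp hp1 h hxy)
    (sub_nonpos.mp (hp.logHessian_nonpos hp1 h0 x y)) hδ hδ1).ne'

theorem AboveRoots.pderiv_add_pderiv [Finite σ] (h : AboveRoots v p) (hp : RealStable p)
    (hp1 : Multiaffine p) {x y : σ} (hxy : pderiv x p + pderiv y p ≠ 0) {δ : ℝ} (hδ : 0 ≤ δ)
    (hδ1 : δ * (potential x p v + potential y p v) ≤ 1) :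
    AboveRoots (v - Pi.single x δ) (pderiv x p + pderiv y p) := by
  intro t ht
  have hvt : v ≤ v + t := le_add_of_nonneg_right ht
  rw [sub_add_eq_add_sub]
  exact eval_pderiv_add_pderiv_sub_single_ne_zero hp hp1 (h.mono hvt) hxy hδ <|
    hδ1.trans' <| mul_le_mul_of_nonneg_left
      (add_le_add (potential_le_of_le hp hp1 h hvt x) (potential_le_of_le hp hp1 h hvt y)) hδ

theorem potential_pderiv_add_pderiv_le [Finite σ] (hp : RealStable p) (hp1 : Multiaffine p)
    (h : AboveRoots v p) {x y : σ} (hxy : pderiv x p + pderiv y p ≠ 0) {δ : ℝ} (hδ : 0 ≤ δ)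
    (hδ1 : δ * (potential x p v + potential y p v) ≤ 1) (w : σ) :
    potential w (pderiv x p + pderiv y p) (v - Pi.single x δ) ≤ potential w p v := by
  have h0 := h.eval_ne_zero
  have hb := potential_nonneg hp1 h x
  have hc := potential_nonneg hp1 h y
  have hd := eval_pderiv_pderiv_div_nonneg hp1 h y x
  have hα := hp.logHessian_nonpos hp1 h0 x y
  have hden := add_sub_mul_pos hb hc (potential_add_potential_pos hp hp1 h hxy)
    (sub_nonpos.mp hα) hδ hδ1
  have hτ := hp.logThird_sq_le hp1 h0 x y w
  have hbarrier := mul_add_mul_le_of_sq_le hb hc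
    (neg_nonneg.mpr (hp.logHessian_nonpos hp1 h0 w x))
    (neg_nonneg.mpr (hp.logHessian_nonpos hp1 h0 w y))
    (α := -logHessian x y p v) (τ := logThird w x y p v) (by rw [logHessian]; linarith)
    (by linarith) hδ hδ1
  have hquot : potential w (pderiv x p + pderiv y p) (v - Pi.single x δ) =
      (eval v (pderiv w (pderiv x p)) / eval v p + eval v (pderiv w (pderiv y p)) / eval v p
        - δ * (eval v (pderiv w (pderiv x (pderiv y p))) / eval v p)) /
      (potential x p v + potential y p v - δ * (eval v (pderiv x (pderiv y p)) / eval v p)) := by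
    rw [potential, map_add, pderiv_pderiv_comm w x, pderiv_pderiv_comm w y,
      eval_pderiv_add_pderiv_sub_single (hp1.pderiv w), eval_pderiv_add_pderiv_sub_single hp1,
      pderiv_pderiv_comm y w, pderiv_pderiv_comm x w, pderiv_pderiv_comm x w, potential, potential]
    conv_rhs => rw [← mul_div_mul_left _ _ h0]
    congr 1 <;> field_simp
  rw [hquot, div_le_iff₀ hden]
  simp only [logThird, logHessian] at hbarrier
  linarith

end Barrier

section DiffOp

variable {σ : Type*}

theorem pairwise_commute_partialD_pow (m : σ → ℕ) (S : Set σ) :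
    S.Pairwise (Function.onFun Commute fun i => partialD i ^ m i) :=
  fun i _ j _ _ => (partialD_commute i j).pow_pow (m i) (m j)

variable [Fintype σ]

theorem monomialD_eq_noncommProd (m : σ →₀ ℕ) :
    monomialD m = Finset.univ.noncommProd (fun i => partialD i ^ m i)
      (pairwise_commute_partialD_pow m _) := rfl

theorem monomialD_zero : monomialD (0 : σ →₀ ℕ) = 1 :=
  (Finset.noncommProd_eq_pow_card _ _ _ 1 fun _ _ => pow_zero _).trans (one_pow _)

theorem monomialD_add (s t : σ →₀ ℕ) : monomialD (s + t) = monomialD s * monomialD t := by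
  rw [monomialD_eq_noncommProd, monomialD_eq_noncommProd, monomialD_eq_noncommProd,
    ← Finset.noncommProd_mul_distrib _ _ _ _
      fun i _ j _ _ => (partialD_commute i j).pow_pow (t i) (s j)]
  exact Finset.noncommProd_congr rfl (fun i _ => pow_add _ _ _) _

theorem monomialD_single (i : σ) : monomialD (Finsupp.single i 1) = partialD i := by
  classical
  rw [monomialD_eq_noncommProd, ← Finset.noncommProd_erase_mul _ (Finset.mem_univ i) _ _
      (pairwise_commute_partialD_pow _ _),
    Finset.noncommProd_eq_pow_card _ _ _ 1 fun j hj => ?_, one_pow, one_mul, Finsupp.single_eq_same,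
    pow_one]
  rw [Finsupp.single_eq_of_ne (Finset.ne_of_mem_erase hj), pow_zero]

/-- The algebra homomorphism `q ↦ q(∂)`, of which `diffOp` is the uncurried form. -/
noncomputable def diffOpHom : MvPolynomial σ ℝ →ₐ[ℝ] Module.End ℝ (MvPolynomial σ ℝ) :=
  AddMonoidAlgebra.lift ℝ _ (σ →₀ ℕ)
    { toFun := fun m => monomialD m.toAdd
      map_one' := monomialD_zero
      map_mul' := fun _ _ => monomialD_add _ _ }

theorem diffOpHom_apply (q p : MvPolynomial σ ℝ) : diffOpHom q p = diffOp q p := by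
  simp only [diffOpHom, AddMonoidAlgebra.lift_apply]
  exact LinearMap.sum_apply _ _ _

theorem diffOpHom_monomial (m : σ →₀ ℕ) (c : ℝ) : diffOpHom (monomial m c) = c • monomialD m :=
  AddMonoidAlgebra.lift_single ..

theorem diffOpHom_X (i : σ) : diffOpHom (X i) = partialD i := by
  rw [X, diffOpHom_monomial, one_smul, monomialD_single]

theorem diffOpHom_X_add_X (i j : σ) (p : MvPolynomial σ ℝ) :
    diffOpHom (X i + X j) p = pderiv i p + pderiv j p := by
  rw [map_add, diffOpHom_X, diffOpHom_X]
  rfl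

theorem diffOpHom_mul_X (q p : MvPolynomial σ ℝ) (i : σ) :
    diffOpHom (q * X i) p = diffOpHom q (pderiv i p) := by
  rw [map_mul, diffOpHom_X]
  rfl

theorem diffOpHom_pderiv (q p : MvPolynomial σ ℝ) (i : σ) :
    diffOpHom q (pderiv i p) = pderiv i (diffOpHom q p) := by
  rw [← diffOpHom_mul_X, mul_comm, map_mul, diffOpHom_X]
  rfl

theorem Multiaffine.diffOpHom {p : MvPolynomial σ ℝ} (hp : Multiaffine p) (q : MvPolynomial σ ℝ) :
    Multiaffine (diffOpHom q p) := by
  induction q using MvPolynomial.induction_on generalizing p with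
  | C c =>
    rw [C_eq_smul_one, map_smul, map_one, LinearMap.smul_apply, smul_eq_C_mul]
    exact fun i => (degreeOf_C_mul_le _ _ _).trans (hp i)
  | add q r hq hr =>
    rw [map_add]
    exact (hq hp).add (hr hp)
  | mul_X q i hq =>
    rw [diffOpHom_mul_X]
    exact hq (hp.pderiv i)

end DiffOp

section SeparatedProduct

variable {σ τ : Type*}

theorem notMem_vars_rename {f : σ → τ} {j : τ} (hj : j ∉ Set.range f) (p : MvPolynomial σ ℝ) :
    j ∉ (rename f p).vars := fun h => by
  obtain ⟨i, -, hi⟩ := mem_vars_rename f p h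
  exact hj ⟨i, hi⟩

theorem degreeOf_rename_of_notMem_range {f : σ → τ} {j : τ} (hj : j ∉ Set.range f)
    (p : MvPolynomial σ ℝ) : (rename f p).degreeOf j = 0 :=
  degreeOf_eq_zero_iff_notMem_vars.mpr (notMem_vars_rename hj p)

theorem pderiv_rename_of_notMem_range {f : σ → τ} {j : τ} (hj : j ∉ Set.range f)
    (p : MvPolynomial σ ℝ) : pderiv j (rename f p) = 0 :=
  pderiv_eq_zero_of_notMem_vars (notMem_vars_rename hj p)

/-- The product `f(x) g(y)` of two polynomials in disjoint sets of variables. -/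
noncomputable def separatedProduct (f : MvPolynomial σ ℝ) (g : MvPolynomial τ ℝ) :
    MvPolynomial (σ ⊕ τ) ℝ :=
  rename Sum.inl f * rename Sum.inr g

theorem eval_separatedProduct (f : MvPolynomial σ ℝ) (g : MvPolynomial τ ℝ) (x : σ → ℝ)
    (y : τ → ℝ) : eval (Sum.elim x y) (separatedProduct f g) = eval x f * eval y g := by
  rw [separatedProduct, map_mul, eval_rename, eval_rename, Sum.elim_comp_inl, Sum.elim_comp_inr]

theorem pderiv_inl_separatedProduct (f : MvPolynomial σ ℝ) (g : MvPolynomial τ ℝ) (i : σ) :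
    pderiv (Sum.inl i) (separatedProduct f g) = separatedProduct (pderiv i f) g := by
  rw [separatedProduct, pderiv_mul, pderiv_rename Sum.inl_injective,
    pderiv_rename_of_notMem_range (by simp), mul_zero, add_zero, separatedProduct]

theorem pderiv_inr_separatedProduct (f : MvPolynomial σ ℝ) (g : MvPolynomial τ ℝ) (j : τ) :
    pderiv (Sum.inr j) (separatedProduct f g) = separatedProduct f (pderiv j g) := by
  rw [separatedProduct, pderiv_mul, pderiv_rename Sum.inr_injective,
    pderiv_rename_of_notMem_range (by simp), zero_mul, zero_add, separatedProduct]

theorem RealStable.separatedProduct {f : MvPolynomial σ ℝ} {g : MvPolynomial τ ℝ}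
    (hf : RealStable f) (hg : RealStable g) : RealStable (separatedProduct f g) := fun z hz => by
  rw [ALS.separatedProduct, map_mul, aeval_rename, aeval_rename]
  exact mul_ne_zero (hf _ fun i => hz _) (hg _ fun j => hz _)

theorem Multiaffine.separatedProduct {f : MvPolynomial σ ℝ} {g : MvPolynomial τ ℝ}
    (hf : Multiaffine f) (hg : Multiaffine g) : Multiaffine (separatedProduct f g) := by
  intro i
  refine (degreeOf_mul_le _ _ _).trans ?_
  rcases i with i | j
  · rw [degreeOf_rename_of_injective Sum.inl_injective, degreeOf_rename_of_notMem_range (by simp)]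
    exact hf i
  · rw [degreeOf_rename_of_injective Sum.inr_injective, degreeOf_rename_of_notMem_range (by simp),
      zero_add]
    exact hg j

theorem AboveRoots.separatedProduct {f : MvPolynomial σ ℝ} {g : MvPolynomial τ ℝ} {a : σ → ℝ}
    {b : τ → ℝ} (hf : AboveRoots a f) (hg : AboveRoots b g) :
    AboveRoots (Sum.elim a b) (separatedProduct f g) := fun t ht => by
  have hsplit : Sum.elim a b + t = Sum.elim (a + t ∘ Sum.inl) (b + t ∘ Sum.inr) := by
    ext (i | j) <;> rfl
  rw [hsplit, eval_separatedProduct]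
  exact mul_ne_zero (hf _ fun i => ht _) (hg _ fun j => ht _)

theorem potential_inl_separatedProduct {f : MvPolynomial σ ℝ} {g : MvPolynomial τ ℝ} {a : σ → ℝ}
    {b : τ → ℝ} (hg : eval b g ≠ 0) (i : σ) :
    potential (Sum.inl i) (separatedProduct f g) (Sum.elim a b) = potential i f a := by
  rw [potential, pderiv_inl_separatedProduct, eval_separatedProduct, eval_separatedProduct,
    mul_div_mul_right _ _ hg, potential]

theorem potential_inr_separatedProduct {f : MvPolynomial σ ℝ} {g : MvPolynomial τ ℝ} {a : σ → ℝ}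
    {b : τ → ℝ} (hf : eval a f ≠ 0) (j : τ) :
    potential (Sum.inr j) (separatedProduct f g) (Sum.elim a b) = potential j g b := by
  rw [potential, pderiv_inr_separatedProduct, eval_separatedProduct, eval_separatedProduct,
    mul_div_mul_left _ _ hf, potential]

end SeparatedProduct

section Iteration

variable {ι σ : Type*} [Fintype σ] [DecidableEq σ]

/-- The shifts `1 / φ i` are computed at the initial point `v`; they stay admissible at every step
because no potential increases. -/
theorem barrier_prod_X_add_X {P : MvPolynomial σ ℝ} (hP : RealStable P) (hP1 : Multiaffine P)
    {v : σ → ℝ} (hv : AboveRoots v P) (x y : ι → σ) {φ : ι → ℝ}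
    (hφ : ∀ i, φ i = potential (x i) P v + potential (y i) P v) (S : Finset ι)
    (hne : diffOpHom (∏ i ∈ S, (X (x i) + X (y i))) P ≠ 0) :
    RealStable (diffOpHom (∏ i ∈ S, (X (x i) + X (y i))) P) ∧ (∀ i ∈ S, 0 < φ i) ∧
      AboveRoots (v - ∑ i ∈ S, Pi.single (x i) (1 / φ i))
        (diffOpHom (∏ i ∈ S, (X (x i) + X (y i))) P) ∧
      ∀ w, potential w (diffOpHom (∏ i ∈ S, (X (x i) + X (y i))) P)
        (v - ∑ i ∈ S, Pi.single (x i) (1 / φ i)) ≤ potential w P v := by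
  classical
  induction S using Finset.induction_on with
  | empty => simpa using ⟨hP, hv⟩
  | insert e S he ih =>
    rw [Finset.prod_insert he, map_mul, Module.End.mul_apply, diffOpHom_X_add_X] at hne ⊢
    obtain ⟨hS, hpos, habove, hpot⟩ := ih fun h => hne (by rw [h, map_zero, map_zero, add_zero])
    have hS1 := hP1.diffOpHom (∏ i ∈ S, (X (x i) + X (y i)))
    have hsum := (add_le_add (hpot (x e)) (hpot (y e))).trans_eq (hφ e).symm
    have hφe : 0 < φ e := (potential_add_potential_pos hS hS1 habove hne).trans_le hsum
    have hδ : 0 ≤ 1 / φ e := by positivity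
    have hδ1 := (mul_le_mul_of_nonneg_left hsum hδ).trans_eq (one_div_mul_cancel hφe.ne')
    rw [Finset.sum_insert he, sub_add_eq_sub_sub_swap]
    exact ⟨hS.pderiv_add_pderiv hS1 hne, Finset.forall_mem_insert _ _ _ |>.mpr ⟨hφe, hpos⟩,
      habove.pderiv_add_pderiv hS hS1 hne hδ hδ1, fun w =>
        (potential_pderiv_add_pderiv_le hS hS1 habove hne hδ hδ1 w).trans (hpot w)⟩

end Iteration

section Flip

variable {σ : Type*}

theorem pderiv_prod_X_pow_of_notMem {e : σ} {S : Finset σ} (he : e ∉ S) (m : σ → ℕ) :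
    pderiv e (∏ i ∈ S, (X i : MvPolynomial σ ℝ) ^ m i) = 0 := by
  refine Finset.prod_induction _ (fun a => pderiv e a = 0) (fun a b ha hb => ?_) pderiv_one
    fun i hi => ?_
  · rw [pderiv_mul, ha, hb, zero_mul, mul_zero, add_zero]
  · rw [pderiv_pow, pderiv_X_of_ne (ne_of_mem_of_not_mem hi he), mul_zero]

theorem separatedProduct_X_mul (g h : MvPolynomial σ ℝ) (e : σ) :
    separatedProduct g (X e * h) = X (Sum.inr e) * separatedProduct g h := by
  rw [separatedProduct, map_mul, rename_X, mul_left_comm, separatedProduct]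

variable [Fintype σ]

theorem diffOpHom_prod_mul_left {ι : Type*} {G : MvPolynomial σ ℝ} {q : ι → MvPolynomial σ ℝ}
    {S : Finset ι} (h : ∀ i ∈ S, ∀ F, diffOpHom (q i) (G * F) = G * diffOpHom (q i) F)
    (F : MvPolynomial σ ℝ) :
    diffOpHom (∏ i ∈ S, q i) (G * F) = G * diffOpHom (∏ i ∈ S, q i) F := by
  refine Finset.prod_induction q (fun a => ∀ F, diffOpHom a (G * F) = G * diffOpHom a F)
    (fun a b ha hb F => ?_) (fun F => ?_) h F
  · rw [map_mul diffOpHom, Module.End.mul_apply, hb, ha, Module.End.mul_apply]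
  · rw [map_one, Module.End.one_apply, Module.End.one_apply]

/-- Coordinate by coordinate, `∂ₓ + ∂_y` turns `g(x) y` into `g + y ∂ₓ g`, which for a multiaffine
`g` is `g(x + y)`. -/
theorem eval_diffOpHom_prod_separatedProduct [DecidableEq σ] {s : σ → ℕ} (hs : ∀ e, s e ≤ 1)
    (S : Finset σ) {g : MvPolynomial σ ℝ} (hg : Multiaffine g) (x y : σ → ℝ) :
    eval (Sum.elim x y) (diffOpHom (∏ e ∈ S, (X (Sum.inl e) + X (Sum.inr e)))
        (separatedProduct g (∏ e ∈ S, X e ^ (1 - s e)))) =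
      eval (x + ∑ e ∈ S, Pi.single e (y e)) (diffOpHom (∏ e ∈ S, X e ^ s e) g) := by
  induction S using Finset.induction_on generalizing g with
  | empty => simp [eval_separatedProduct]
  | insert e S he ih =>
    have hpderiv := pderiv_prod_X_pow_of_notMem he fun i => 1 - s i
    rw [Finset.prod_insert he, Finset.prod_insert he, Finset.prod_insert he, Finset.sum_insert he,
      add_left_comm, ← add_comm (x + _), eval_add_single (hg.diffOpHom _ e), mul_comm, map_mul,
      Module.End.mul_apply, diffOpHom_X_add_X, pderiv_inl_separatedProduct,
      pderiv_inr_separatedProduct, ← diffOpHom_pderiv, mul_comm (X e ^ s e), pderiv_mul, hpderiv,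
      mul_zero, add_zero]
    rcases Nat.le_one_iff_eq_zero_or_eq_one.mp (hs e) with h0 | h1
    · have hcomm : ∀ i ∈ S, ∀ F : MvPolynomial (σ ⊕ σ) ℝ,
          diffOpHom (X (Sum.inl i) + X (Sum.inr i)) (X (Sum.inr e) * F) =
            X (Sum.inr e) * diffOpHom (X (Sum.inl i) + X (Sum.inr i)) F := fun i hi F => by
        have hie : Sum.inr e ≠ (Sum.inr i : σ ⊕ σ) :=
          Sum.inr_injective.ne (ne_of_mem_of_not_mem hi he).symm
        simp only [diffOpHom_X_add_X, pderiv_mul, pderiv_X_of_ne hie,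
          pderiv_X_of_ne Sum.inr_ne_inl, zero_mul, zero_add, mul_add]
      rw [h0, pow_zero, mul_one, Nat.sub_zero, pow_one, pderiv_X_self, one_mul,
        separatedProduct_X_mul, map_add, diffOpHom_prod_mul_left hcomm, map_add, map_mul, eval_X,
        ih hg, ih (hg.pderiv e)]
      exact add_comm _ _
    · rw [h1, Nat.sub_self, pow_zero, one_mul, pderiv_one, zero_mul, pow_one, diffOpHom_mul_X,
        diffOpHom_mul_X, ← ih (hg.pderiv e), pderiv_pderiv_self (hg e)]
      simp [separatedProduct]

theorem diffOp_eq_sum (q p : MvPolynomial σ ℝ) :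
    diffOp q p = ∑ s ∈ q.support, coeff s q • diffOpHom (∏ e, X e ^ s e) p := by
  refine Finset.sum_congr rfl fun s _ => ?_
  rw [← one_smul ℝ (monomialD s), ← diffOpHom_monomial, monomial_eq, C_1, one_mul,
    Finsupp.prod_fintype _ _ fun _ => pow_zero _]

theorem flip_eq_sum (q : MvPolynomial σ ℝ) :
    flip q = ∑ s ∈ q.support, coeff s q • ∏ e, X e ^ (1 - s e) := by
  refine Finset.sum_congr rfl fun s _ => ?_
  rw [monomial_eq, Finsupp.prod_fintype _ _ fun _ => pow_zero _, smul_eq_C_mul]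
  rfl

theorem eval_diffOpHom_prod_separatedProduct_flip {f h : MvPolynomial σ ℝ} (hf : Multiaffine f)
    (hh : Multiaffine h) (x y : σ → ℝ) :
    eval (Sum.elim x y) (diffOpHom (∏ e, (X (Sum.inl e) + X (Sum.inr e)))
      (separatedProduct f (flip h))) = eval (x + y) (diffOp h f) := by
  classical
  have hsum : separatedProduct f (flip h) =
      ∑ s ∈ h.support, coeff s h • separatedProduct f (∏ e, X e ^ (1 - s e)) := by
    simp only [flip_eq_sum, separatedProduct, map_sum, map_smul, Finset.mul_sum, mul_smul_comm]
  rw [hsum, diffOp_eq_sum, map_sum, map_sum, map_sum]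
  refine Finset.sum_congr rfl fun s hs => ?_
  rw [map_smul, smul_eval, smul_eval, eval_diffOpHom_prod_separatedProduct
    (fun e => (monomial_le_degreeOf e hs).trans (hh e)) _ hf, Finset.univ_sum_single]

theorem aeval_flip {h : MvPolynomial σ ℝ} (hh : Multiaffine h) {z : σ → ℂ} (hz : ∀ e, z e ≠ 0) :
    aeval z (flip h) = (∏ e, z e) * aeval (fun e => (z e)⁻¹) h := by
  rw [flip_eq_sum, map_sum, aeval_def (fun e => (z e)⁻¹), eval₂_eq', Finset.mul_sum]
  refine Finset.sum_congr rfl fun m hm => ?_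
  rw [map_smul, Algebra.smul_def, map_prod, mul_left_comm, ← Finset.prod_mul_distrib]
  congr 1
  refine Finset.prod_congr rfl fun e _ => ?_
  rw [map_pow, aeval_X, pow_sub₀ _ (hz e) ((monomial_le_degreeOf e hm).trans (hh e)), pow_one,
    inv_pow]

theorem RealStable.flip {h : MvPolynomial σ ℝ} (hh : RealStable h) (hh1 : Multiaffine h) :
    RealStable (flip h) := fun z hz => by
  have hz0 : ∀ e, z e ≠ 0 := fun e he => (hz e).ne' (by rw [he, Complex.zero_im])
  rw [aeval_flip hh1 hz0]
  refine mul_ne_zero (Finset.prod_ne_zero_iff.mpr fun e _ => hz0 e) fun h0 => ?_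
  refine hh (fun e => starRingEnd ℂ (z e)⁻¹) (fun e => ?_) (by rw [aeval_conj, h0, map_zero])
  rw [Complex.conj_im, Complex.inv_im, neg_div, neg_neg]
  exact div_pos (hz e) (Complex.normSq_pos.mpr (hz0 e))

theorem multiaffine_flip (h : MvPolynomial σ ℝ) : Multiaffine (flip h) := by
  classical
  intro e
  refine (degreeOf_sum_le e _ _).trans (Finset.sup_le fun m _ => degreeOf_le_iff.mpr fun n hn => ?_)
  rw [Finset.mem_singleton.mp (support_monomial_subset hn),
    Finsupp.equivFunOnFinite_symm_apply_apply]
  exact Nat.sub_le _ _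

end Flip

section Multiaffine

variable {σ : Type*} [Fintype σ]

theorem barrier_diffOp_multiaffine {f h : MvPolynomial σ ℝ} (hf : RealStable f)
    (hf1 : Multiaffine f) (hh : RealStable h) (hh1 : Multiaffine h) (hne : diffOp h f ≠ 0)
    {v w φ : σ → ℝ} (hv : AboveRoots v f) (hw : AboveRoots w (flip h))
    (hφ : ∀ i, φ i = potential i f v + potential i (flip h) w) :
    (∀ i, 0 < φ i) ∧ AboveRoots (fun i => v i + w i - 1 / φ i) (diffOp h f) := by
  classical
  have heval := eval_diffOpHom_prod_separatedProduct_flip hf1 hh1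
  have hne' : diffOpHom (∏ e, (X (Sum.inl e) + X (Sum.inr e))) (separatedProduct f (flip h)) ≠ 0 :=
    fun h0 => hne (MvPolynomial.funext fun x => by simpa [h0] using (heval x 0).symm)
  obtain ⟨-, hpos, habove, -⟩ := barrier_prod_X_add_X (hf.separatedProduct (hh.flip hh1))
    (hf1.separatedProduct (multiaffine_flip h)) (hv.separatedProduct hw) Sum.inl Sum.inr
    (φ := φ) (fun i => by
      rw [potential_inl_separatedProduct hw.eval_ne_zero,
        potential_inr_separatedProduct hv.eval_ne_zero, hφ]) Finset.univ hne'
  refine ⟨fun i => hpos i (Finset.mem_univ i), fun t ht => ?_⟩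
  have hpoint : Sum.elim v w - ∑ i, Pi.single (Sum.inl i) (1 / φ i) + Sum.elim t 0 =
      Sum.elim (fun i => v i - 1 / φ i + t i) w := by
    ext (i | i) <;> simp [Finset.sum_apply, Pi.single_apply]
  have ht' : ∀ i, 0 ≤ (Sum.elim t 0 : σ ⊕ σ → ℝ) i := by
    rintro (i | _)
    exacts [ht i, le_rfl]
  have h0 := habove _ ht'
  have hsum : (fun i => v i - 1 / φ i + t i) + w = (fun i => v i + w i - 1 / φ i) + t := by
    ext i
    simp only [Pi.add_apply]
    ring
  rwa [hpoint, heval, hsum] at h0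

end Multiaffine

section Diagonal

variable {σ τ : Type*}

theorem AboveRoots.rename {f : σ → τ} {F : MvPolynomial σ ℝ} {c : τ → ℝ}
    (h : AboveRoots (c ∘ f) F) : AboveRoots c (rename f F) := fun t ht => by
  rw [eval_rename]
  exact h (t ∘ f) fun i => ht _

theorem pderiv_rename_fst {κ : Type*} [Fintype κ] (i : σ) (F : MvPolynomial (σ × κ) ℝ) :
    pderiv i (rename Prod.fst F) = rename Prod.fst (∑ j, pderiv (i, j) F) := by
  classical
  induction F using MvPolynomial.induction_on with
  | C a => simp
  | add p q hp hq => simp only [map_add, hp, hq, Finset.sum_add_distrib]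
  | mul_X p e h =>
    have hX : pderiv i (X e.1 : MvPolynomial σ ℝ) =
        rename Prod.fst (∑ j, pderiv (i, j) (X e : MvPolynomial (σ × κ) ℝ)) := by
      simp [pderiv_X, Pi.single_apply, Prod.ext_iff, ite_and, eq_comm]
    simp only [map_mul, rename_X, pderiv_mul, h, hX, map_sum, map_add, Finset.sum_add_distrib,
      Finset.sum_mul, Finset.mul_sum]

theorem rename_fst_diffOp_tilde [Fintype σ] (k : ℕ) (q : MvPolynomial σ ℝ)
    (F : MvPolynomial (σ × Fin k) ℝ) :
    rename Prod.fst (diffOp (tilde k q) F) = diffOp q (rename Prod.fst F) := by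
  rw [← diffOpHom_apply, ← diffOpHom_apply, tilde]
  induction q using MvPolynomial.induction_on generalizing F with
  | C c => simp [C_eq_smul_one]
  | add p q hp hq => simp only [map_add, LinearMap.add_apply, hp, hq]
  | mul_X q i h =>
    rw [diffOpHom_mul_X, pderiv_rename_fst, ← h, map_mul, aeval_X, Finset.mul_sum]
    simp only [map_sum, LinearMap.sum_apply, diffOpHom_mul_X]

theorem RealStable.tilde {k : ℕ} (hk : 0 < k) {q : MvPolynomial σ ℝ} (hq : RealStable q) :
    RealStable (tilde k q) := fun z hz => by
  rw [ALS.tilde, comp_aeval_apply]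
  refine hq _ fun i => ?_
  rw [map_sum, Complex.im_sum]
  exact Finset.sum_pos (fun j _ => by simpa using hz _) ⟨⟨0, hk⟩, Finset.mem_univ _⟩

end Diagonal

section BlockDegree

variable {σ τ : Type*}

theorem degreeOf_prod_le_of_forall_ne [Fintype σ] {F : σ → MvPolynomial τ ℝ} {e : τ} {i : σ}
    (h : ∀ l ≠ i, (F l).degreeOf e = 0) : (∏ l, F l).degreeOf e ≤ (F i).degreeOf e :=
  (degreeOf_prod_le _ _ _).trans_eq <|
    Finset.sum_eq_single i (fun l _ hl => h l hl) fun hi => absurd (Finset.mem_univ i) hi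

theorem degreeOf_esymm_le [Fintype τ] (d : ℕ) (j : τ) : (esymm τ ℝ d).degreeOf j ≤ 1 := by
  classical
  refine (degreeOf_sum_le j _ _).trans (Finset.sup_le fun t _ => (degreeOf_prod_le _ _ _).trans ?_)
  simp only [degreeOf_X]
  rw [Finset.sum_ite_eq]
  split_ifs <;> simp

theorem degreeOf_rename_mk_esymm_le {κ : Type*} [Fintype κ] (d : ℕ) (e : σ × κ) :
    (rename (fun j => (e.1, j)) (esymm κ ℝ d)).degreeOf e ≤ 1 :=
  (degreeOf_rename_of_injective (Prod.mk_right_injective e.1) e.2).trans_le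
    (degreeOf_esymm_le d e.2)

theorem degreeOf_rename_mk_eq_zero {κ : Type*} {i : σ} {e : σ × κ} (h : i ≠ e.1)
    (p : MvPolynomial κ ℝ) : (rename (fun j => (i, j)) p).degreeOf e = 0 :=
  degreeOf_rename_of_notMem_range (fun ⟨_, hj⟩ => h (congrArg Prod.fst hj)) p

theorem Multiaffine.tilde [Finite σ] {q : MvPolynomial σ ℝ} (hq : Multiaffine q) (k : ℕ) :
    Multiaffine (tilde k q) := fun e => by
  classical
  have := Fintype.ofFinite σ
  have hblock : ∀ i, ∑ j : Fin k, (X (i, j) : MvPolynomial (σ × Fin k) ℝ) =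
      rename (fun j => (i, j)) (esymm (Fin k) ℝ 1) := fun i => by
    simp only [esymm_one, map_sum, rename_X]
  rw [ALS.tilde, aeval_def, eval₂_eq', algebraMap_eq]
  simp only [hblock]
  refine (degreeOf_sum_le e _ _).trans (Finset.sup_le fun m hm => ?_)
  refine (degreeOf_C_mul_le _ _ _).trans <|
    (degreeOf_prod_le_of_forall_ne (i := e.1) fun i hi => ?_).trans <|
      (degreeOf_pow_le _ _ _).trans <|
        (Nat.mul_le_mul_left _ (degreeOf_rename_mk_esymm_le _ _)).trans ?_
  · exact Nat.le_zero.mp <| (degreeOf_pow_le _ _ _).trans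
      (by rw [degreeOf_rename_mk_eq_zero hi, mul_zero])
  · rw [mul_one]
    exact (monomial_le_degreeOf e.1 hm).trans (hq e.1)

theorem multiaffine_polarization [Fintype σ] (k : ℕ) (p : MvPolynomial σ ℝ) :
    Multiaffine (polarization k p) := fun e => by
  classical
  refine (degreeOf_sum_le e _ _).trans (Finset.sup_le fun m _ => ?_)
  refine (degreeOf_C_mul_le _ _ _).trans <|
    (degreeOf_prod_le_of_forall_ne (i := e.1) fun i hi => ?_).trans <|
      (degreeOf_C_mul_le _ _ _).trans (degreeOf_rename_mk_esymm_le _ _)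
  exact Nat.le_zero.mp <| (degreeOf_C_mul_le _ _ _).trans (degreeOf_rename_mk_eq_zero hi _).le

end BlockDegree

section Symmetry

variable {σ : Type*}

theorem potential_rename {τ : Type*} {f : σ → τ} (hf : Function.Injective f) (i : σ)
    (F : MvPolynomial σ ℝ) (a : τ → ℝ) :
    potential (f i) (rename f F) a = potential i F (a ∘ f) := by
  rw [potential, pderiv_rename hf, eval_rename, eval_rename, potential]

theorem potential_repeated_eq {k : ℕ} {F : MvPolynomial (σ × Fin k) ℝ}
    (hF : ∀ π : Equiv.Perm (Fin k), rename ((Equiv.refl σ).prodCongr π) F = F)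
    (a : σ → ℝ) (i : σ) (j l : Fin k) :
    potential (i, j) F (repeated k a) = potential (i, l) F (repeated k a) := by
  conv_lhs => rw [← hF (Equiv.swap l j)]
  have hswap : (i, j) = (Equiv.refl σ).prodCongr (Equiv.swap l j) (i, l) := by simp
  rw [hswap, potential_rename (Equiv.injective _)]
  rfl

theorem rename_tilde (k : ℕ) (q : MvPolynomial σ ℝ) (π : Equiv.Perm (Fin k)) :
    rename ((Equiv.refl σ).prodCongr π) (tilde k q) = tilde k q := by
  rw [tilde, comp_aeval_apply]
  simp only [map_sum, rename_X, Equiv.prodCongr_apply, Prod.map_apply, Equiv.refl_apply]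
  congr 2
  ext1 i
  exact Equiv.sum_comp π fun j => X (i, j)

variable [Fintype σ]

theorem rename_polarization (k : ℕ) (p : MvPolynomial σ ℝ) (π : Equiv.Perm (Fin k)) :
    rename ((Equiv.refl σ).prodCongr π) (polarization k p) = polarization k p := by
  have hcomp : ∀ i : σ, (Equiv.refl σ).prodCongr π ∘ (fun j => (i, j)) = (fun j => (i, j)) ∘ π :=
    fun _ => rfl
  simp only [polarization, map_sum, map_mul, map_prod, rename_C, rename_rename, hcomp]
  simp only [← rename_rename, rename_esymm]

theorem rename_flip (π : Equiv.Perm σ) (h : MvPolynomial σ ℝ) :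
    rename π (flip h) = flip (rename π h) := by
  classical
  rw [flip, flip, map_sum, support_rename_of_injective π.injective,
    Finset.sum_image (Finsupp.mapDomain_injective π.injective).injOn]
  refine Finset.sum_congr rfl fun m _ => ?_
  rw [rename_monomial, coeff_rename_mapDomain _ π.injective]
  congr 2
  ext i
  simp [Finsupp.mapDomain_equiv_apply]

end Symmetry

end ALS

open ALS MvPolynomial in
theorem mainTheorem2_general {σ : Type*} [Fintype σ] (k : ℕ) (hk : 0 < k) (p q : MvPolynomial σ ℝ)
    (hp : ALS.RealStable p) (hq : ALS.RealStable q)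
    (hpk : ∀ i, p.degreeOf i ≤ k) (hq1 : ALS.Multiaffine q)
    (hr : ALS.diffOp q p ≠ 0)
    (a b : σ → ℝ) (ha : ALS.AboveRoots a p)
    (hb : ALS.AboveRoots (ALS.repeated k b) (ALS.flip (ALS.tilde k q)))
    (φ : σ → ℝ)
    (hφ : ∀ i, φ i =
      ALS.potential (i, ⟨0, hk⟩) (ALS.polarization k p) (ALS.repeated k a) +
      ALS.potential (i, ⟨0, hk⟩) (ALS.flip (ALS.tilde k q)) (ALS.repeated k b)) :
    (∀ i, 0 < φ i) ∧
      ALS.AboveRoots (fun i => a i + b i - 1 / φ i) (ALS.diffOp q p) := by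
  have hdiag : rename Prod.fst (diffOp (tilde k q) (polarization k p)) = diffOp q p := by
    rw [rename_fst_diffOp_tilde, rename_fst_polarization hpk]
  have hφ' : ∀ e : σ × Fin k, repeated k φ e = potential e (polarization k p) (repeated k a) +
      potential e (flip (tilde k q)) (repeated k b) := fun ⟨i, j⟩ => by
    rw [potential_repeated_eq (rename_polarization k p) a i j ⟨0, hk⟩,
      potential_repeated_eq (fun π => by rw [rename_flip, rename_tilde]) b i j ⟨0, hk⟩]
    exact hφ i
  obtain ⟨hpos, habove⟩ := barrier_diffOp_multiaffine (hp.polarization hpk)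
    (multiaffine_polarization k p) (hq.tilde hk) (hq1.tilde k)
    (fun h0 => hr (by rw [← hdiag, h0, map_zero])) (ha.polarization hp hpk) hb hφ'
  refine ⟨fun i => hpos (i, ⟨0, hk⟩), ?_⟩
  rw [← hdiag]
  exact AboveRoots.rename habove

theorem mainTheorem2 (n k : ℕ) (hk : 0 < k) (p q : MvPolynomial (Fin n) ℝ)
    (hp : ALS.RealStable p) (hq : ALS.RealStable q)
    (hpk : ∀ i, p.degreeOf i ≤ k) (hq1 : ALS.Multiaffine q)
    (hr : ALS.diffOp q p ≠ 0)
    (a b : Fin n → ℝ) (ha : ALS.AboveRoots a p)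
    (hb : ALS.AboveRoots (ALS.repeated k b) (ALS.flip (ALS.tilde k q)))
    (φ : Fin n → ℝ)
    (hφ : ∀ i, φ i =
      ALS.potential (i, ⟨0, hk⟩) (ALS.polarization k p) (ALS.repeated k a) +
      ALS.potential (i, ⟨0, hk⟩) (ALS.flip (ALS.tilde k q)) (ALS.repeated k b)) :
    (∀ i, 0 < φ i) ∧
      ALS.AboveRoots (fun i => a i + b i - 1 / φ i) (ALS.diffOp q p) :=
  mainTheorem2_general k hk p q hp hq hpk hq1 hr a b ha hb φ hφ
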